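/- Let $\beta,\varepsilon,\mu$ be real constants with $\beta\neq 0$ and $\varepsilon\mu>0$. Let $\mathbb H(\mathbb C)$ be the algebra of complex quaternions with units $i_1,i_2,i_3$ (the complex unit $i$ commutes with them), identify $x\in\mathbb R^3$ with $x_1i_1+x_2i_2+x_3i_3$, and put $D=\sum_{k=1}^3 i_k\partial_{x_k}$ and $$M=\beta\sqrt{\varepsilon\mu}\,\partial_tD+\sqrt{\varepsilon\mu}\,\partial_t-iD .$$ For $\alpha\in\mathbb C$ and $x\neq0$ let $$\Theta_\alpha(x)=-\frac{e^{i\alpha|x|}}{4\pi|x|},\qquad \mathcal K_\alpha(x)=\Bigl(\alpha+\frac{x}{|x|^2}-i\alpha\frac{x}{|x|}\Bigr)\Theta_\alpha(x).$$ Let $H$ be the Heaviside function, $J_0,J_1$ the Bessel functions of the first kind, and define on $\mathbb R\times\mathbb R^3$ $$f(t,x)=H(t)\,\frac{e^{it/(\beta\sqrt{\varepsilon\mu})}}{\beta\sqrt{\varepsilon\mu}}\Bigl[\mathcal K_{1/\beta}(x)\,J_0\Bigl(\tfrac{2\sqrt{t|x|}}{\beta(\varepsilon\mu)^{1/4}}\Bigr)+\frac{i\Theta_{1/\beta}(x)}{\beta(\varepsilon\mu)^{1/4}}\Bigl(1-\frac{ix}{|x|}\Bigr)\sqrt{\tfrac{t}{|x|}}\;J_1\Bigl(\tfrac{2\sqrt{t|x|}}{\beta(\varepsilon\mu)^{1/4}}\Bigr)\Bigr].$$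 Then the following hold. 1. $f$ is locally integrable on $\mathbb R\times\mathbb R^3$ and is a fundamental solution of $M$: $Mf=\delta(t,x)$ in the sense of distributions. 2. $f$ is causal: $f(t,x)=0$ for $t<0$. 3. For $z\in\mathbb C$ with $\operatorname{Im}z\le 0$ and $z\neq 1/(\beta\sqrt{\varepsilon\mu})$ put $\alpha(z)=\dfrac{\sqrt{\varepsilon\mu}\,z}{\beta\sqrt{\varepsilon\mu}\,z-1}$ and $F(z,x)=\dfrac{\mathcal K_{\alpha(z)}(x)}{i(\beta\sqrt{\varepsilon\mu}\,z-1)}$. Then $F(z,\cdot)$ is locally integrable on $\mathbb R^3$ and is a fundamental solution of the operator obtained from $M$ by Fourier transform in $t$: $(\beta\sqrt{\varepsilon\mu}\,iz\,D+\sqrt{\varepsilon\mu}\,iz-iD)F(z,\cdot)=\delta(x)$ in the sense of distributions. 4. $f$ is the regularized inverse Fourier transform of $F$: for all $t\neq0$ and $x\neq0$, $$f(t,x)=\lim_{y\to0^+}\frac1{2\pi}\int_{-\infty}^{\infty}F(\omega-iy,x)\,e^{i\omega t}\,d\omega ,$$ where, for every $y>0$, the integral converges as an improper integral at both ends. -/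

import Mathlib

open MeasureTheory Filter Topology
open scoped Quaternion ContDiff

noncomputable section

namespace ChiralMaxwell

/-- Physical space `ℝ³` with its Euclidean norm. -/
abbrev E3 : Type := EuclideanSpace ℝ (Fin 3)

/-- Time-space `ℝ × ℝ³`, with points `(t, x)`. -/
abbrev Spacetime : Type := ℝ × E3

/-- The algebra `ℍ(ℂ)` of complex quaternions (biquaternions). Its complex unit `Complex.I` acts by
scalar multiplication and commutes with the quaternionic units. -/
abbrev BQ : Type := ℍ[ℂ]

/-- The four complex coordinates of a biquaternion. -/
def coords (q : BQ) : Fin 4 → ℂ := ![q.re, q.imI, q.imJ, q.imK]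

/-- The biquaternion with given coordinates. -/
def ofCoords (c : Fin 4 → ℂ) : BQ := ⟨c 0, c 1, c 2, c 3⟩

/-- The quaternionic imaginary units `i₁, i₂, i₃`. -/
def unit (k : Fin 3) : BQ :=
  ⟨0, if k = 0 then 1 else 0, if k = 1 then 1 else 0, if k = 2 then 1 else 0⟩

/-- A point `x` of `ℝ³` as the purely vectorial biquaternion `x₁ i₁ + x₂ i₂ + x₃ i₃`. -/
def vec (x : E3) : BQ := ∑ k, ((x k : ℝ) : ℂ) • unit k

/-- The coordinatewise integral of a biquaternion-valued function. -/
def bqIntegral {X : Type*} [MeasurableSpace X] (ν : Measure X) (g : X → BQ) : BQ :=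
  ofCoords (fun m => ∫ p, coords (g p) m ∂ν)

/-- Coordinatewise convergence of biquaternions. -/
def BQTendsto {ι : Type*} (u : ι → BQ) (l : Filter ι) (q : BQ) : Prop :=
  ∀ m, Tendsto (fun i => coords (u i) m) l (𝓝 (coords q m))

/-- Local integrability of a biquaternion-valued function, coordinatewise. -/
def BQLocallyIntegrable {X : Type*} [TopologicalSpace X] [MeasurableSpace X]
    (ν : Measure X) (g : X → BQ) : Prop :=
  ∀ m, LocallyIntegrable (fun p => coords (g p) m) ν

/-! ### Biquaternion-valued distributions

A distribution acts on complex test functions (smooth with compact support). It is represented here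
by a map defined on all functions, of which only the values at test functions are ever used. -/

section Distributions

variable {X : Type*} [NormedAddCommGroup X] [NormedSpace ℝ X]

/-- `φ` is a test function: infinitely differentiable with compact support. -/
def IsTest (φ : X → ℂ) : Prop := ContDiff ℝ ∞ φ ∧ HasCompactSupport φ

/-- The regular distribution `φ ↦ ∫ φ g` of a function `g`. -/
def regular [MeasureSpace X] (g : X → BQ) (φ : X → ℂ) : BQ :=
  bqIntegral volume (fun p => φ p • g p)

/-- The distributional derivative in the direction `v`: `⟨∂ᵥT, φ⟩ = -⟨T, ∂ᵥφ⟩`. -/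
def distDeriv (v : X) (T : (X → ℂ) → BQ) (φ : X → ℂ) : BQ :=
  -T (fun p => fderiv ℝ φ p v)

/-- The operator `D = ∑ₖ iₖ ∂ₖ` on distributions, where `∂ₖ` is the derivative along `e k`. -/
def distD (e : Fin 3 → X) (T : (X → ℂ) → BQ) (φ : X → ℂ) : BQ :=
  ∑ k, unit k * distDeriv (e k) T φ

end Distributions

/-- The coordinate directions of `ℝ³`. -/
def dirE3 (k : Fin 3) : E3 := EuclideanSpace.single k 1

/-- The spatial coordinate directions of `ℝ × ℝ³`. -/
def dirX (k : Fin 3) : Spacetime := (0, dirE3 k)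

/-- The time direction of `ℝ × ℝ³`. -/
def dirT : Spacetime := (1, 0)

/-- The chiral Maxwell operator `M = β √(εμ) ∂ₜ D + √(εμ) ∂ₜ - i D` on distributions. -/
def chiralM (β ε μ : ℝ) (T : (Spacetime → ℂ) → BQ) (φ : Spacetime → ℂ) : BQ :=
  ((β * √(ε * μ) : ℝ) : ℂ) • distDeriv dirT (distD dirX T) φ
    + ((√(ε * μ) : ℝ) : ℂ) • distDeriv dirT T φ
    - Complex.I • distD dirX T φ

/-- The operator `β √(εμ) i z D + √(εμ) i z - i D` on distributions over `ℝ³`, obtained from `M` by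
replacing `∂ₜ` with `i z`. -/
def chiralMHat (β ε μ : ℝ) (z : ℂ) (T : (E3 → ℂ) → BQ) (φ : E3 → ℂ) : BQ :=
  (((β * √(ε * μ) : ℝ) : ℂ) * Complex.I * z) • distD dirE3 T φ
    + (((√(ε * μ) : ℝ) : ℂ) * Complex.I * z) • T φ
    - Complex.I • distD dirE3 T φ

/-- The locally integrable function `g` is a fundamental solution of the operator `L`, that is,
`L g = δ` in the sense of distributions, `δ` being the Dirac delta at the origin. -/
def IsFundamentalSolution {X : Type*} [NormedAddCommGroup X] [NormedSpace ℝ X] [MeasureSpace X]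
    (L : ((X → ℂ) → BQ) → (X → ℂ) → BQ) (g : X → BQ) : Prop :=
  BQLocallyIntegrable volume g ∧
    ∀ φ : X → ℂ, IsTest φ → L (regular g) φ = φ 0 • (1 : BQ)

/-! ### The explicit functions -/

/-- The Heaviside function. -/
def heaviside (t : ℝ) : ℝ := if 0 ≤ t then 1 else 0

/-- The Bessel function of the first kind `Jₙ` of integer order `n ≥ 0` (an everywhere convergent
series). -/
def besselJ (n : ℕ) (r : ℝ) : ℝ :=
  ∑' m : ℕ, (-1) ^ m / ((m.factorial : ℝ) * ((m + n).factorial : ℝ)) * (r / 2) ^ (2 * m + n)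

/-- The fundamental solution `Θ_α(x) = -exp(iα|x|) / (4π|x|)` of the Helmholtz operator. -/
def Theta (α : ℂ) (x : E3) : ℂ :=
  -Complex.exp (Complex.I * α * (‖x‖ : ℂ)) / (4 * (Real.pi : ℂ) * (‖x‖ : ℂ))

/-- The fundamental solution `K_α(x) = (α + x/|x|² - iα x/|x|) Θ_α(x)` of `D + α`. -/
def Kfun (α : ℂ) (x : E3) : BQ :=
  Theta α x • (α • (1 : BQ) + (1 / (‖x‖ : ℂ) ^ 2) • vec x
    - (Complex.I * α / (‖x‖ : ℂ)) • vec x)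

/-- The wave number `α(z) = √(εμ) z / (β √(εμ) z - 1)`. -/
def alphaOf (β ε μ : ℝ) (z : ℂ) : ℂ :=
  ((√(ε * μ) : ℝ) : ℂ) * z / (((β * √(ε * μ) : ℝ) : ℂ) * z - 1)

/-- The Fourier-side function `F(z, x)`, given by `(β √(εμ) z - 1) i F(z, x) = K_{α(z)}(x)`. -/
def FourierGreen (β ε μ : ℝ) (z : ℂ) (x : E3) : BQ :=
  (1 / ((((β * √(ε * μ) : ℝ) : ℂ) * z - 1) * Complex.I)) • Kfun (alphaOf β ε μ z) x

/-- `q` is the value at `t` of the inverse Fourier transform of `G`, the integral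
`(1/2π) ∫_{-∞}^{∞} G(w) exp(iwt) dw` being improper at both ends. -/
def HasInverseFourier (G : ℝ → BQ) (t : ℝ) (q : BQ) : Prop :=
  BQTendsto
    (fun R : ℝ × ℝ => ((1 / (2 * Real.pi) : ℝ) : ℂ) •
      bqIntegral (volume.restrict (Set.Ioc (-R.1) R.2))
        (fun w => Complex.exp (Complex.I * w * t) • G w))
    (atTop ×ˢ atTop) q

/-- The argument `2 √(t|x|) / (β (εμ)^{1/4})` of the Bessel functions. -/
def besselArg (β ε μ t : ℝ) (x : E3) : ℝ :=
  2 * √(t * ‖x‖) / (β * (ε * μ) ^ (1 / 4 : ℝ))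

/-- The explicit Green function `f(t, x)` of the chiral Maxwell operator. -/
def green (β ε μ : ℝ) (p : Spacetime) : BQ :=
  ((heaviside p.1 : ℂ) * Complex.exp (Complex.I * p.1 / ((β * √(ε * μ) : ℝ) : ℂ))
      / ((β * √(ε * μ) : ℝ) : ℂ)) •
    (((besselJ 0 (besselArg β ε μ p.1 p.2) : ℝ) : ℂ) • Kfun ((1 / β : ℝ) : ℂ) p.2
      + (Complex.I * Theta ((1 / β : ℝ) : ℂ) p.2 / ((β * (ε * μ) ^ (1 / 4 : ℝ) : ℝ) : ℂ)
          * ((√(p.1 / ‖p.2‖) : ℝ) : ℂ) * ((besselJ 1 (besselArg β ε μ p.1 p.2) : ℝ) : ℂ)) •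
        ((1 : BQ) - (Complex.I / (‖p.2‖ : ℂ)) • vec p.2))

end ChiralMaxwell

end

noncomputable section

namespace ChiralMaxwell

/-! ### Test functions -/

section Test

variable {X : Type*} [NormedAddCommGroup X] [NormedSpace ℝ X] {φ : X → ℂ}

/-! Write a = √(εμ) and b = βa. Two mechanisms carry the proof: a distributional identity for K_α,
and an average over the unit circle that turns separated kernels into the Bessel formula.

Since ∂ₖΘ_α = xₖ·`helmQ`, one has K_α = (α − D)Θ_α, and D² = −Δ gives (D + α)K_α = (Δ + α²)Θ_α = δ.
The last equality is obtained by replacing |x| with ρ = √(|x|² + η²), integrating by parts with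
smooth functions, and letting η → 0; the defect of the Helmholtz equation is an approximate identity
(`tendsto_integral_delta_reg`). The Fourier-side claim follows because the transformed operator is
i(bz − 1)(D + α(z)).

For the operator in spacetime take T = H(t)e^{lt}K_α(x). If α(bl − i) = al, the multiples of T in MT
cancel, and MT = b δ(t)δ(x) + (a − bα) δ(t)K_α + (bl − i) H(t)e^{lt}δ(x) (`chiralM_Tfun`). This
curve of pairs (l, α) is parametrized by l = i(w + 1)/b, α = 1/β + 1/(βw), and the last two
coefficients become −a/w and iw. In the mean over |w| = 1 both terms vanish: w⁻¹K_α is a series in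
negative powers of w, and w e^{lt} is entire in w and zero at w = 0. What remains is bδ. Moreover f
is b⁻¹ times the mean of T (`coords_green_eq_mean`): by `coords_Kfun_add` only means of
e^{A/w}e^{Bw}w^{-k} occur, and these are Bessel series (`integral_circle_cexp_cexp`).

For the inverse Fourier transform, F(w − iy, x) is a Laurent series in w − p with p = 1/b + iy.
Powers of order at least 2 are inverted by Fourier inversion of sⁿ⁺¹e^{ips}, the simple pole by one
integration by parts, and the sum is again a Bessel series. The result is exactly e^{−yt}f(t, x). -/

theorem IsTest.continuous (h : IsTest φ) : Continuous φ := h.1.continuous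

theorem IsTest.differentiable (h : IsTest φ) : Differentiable ℝ φ :=
  h.1.differentiable (by simp)

theorem IsTest.fderiv_apply (h : IsTest φ) (v : X) : IsTest (fun p => fderiv ℝ φ p v) :=
  ⟨(h.1.fderiv_right (m := ∞) (by simp)).clm_apply contDiff_const, h.2.fderiv_apply ℝ v⟩

theorem IsTest.fderiv_comm (h : IsTest φ) (v w p : X) :
    fderiv ℝ (fun p => fderiv ℝ φ p v) p w = fderiv ℝ (fun p => fderiv ℝ φ p w) p v := by
  have hd : DifferentiableAt ℝ (fderiv ℝ φ) p :=
    (h.1.fderiv_right (m := ∞) (by simp)).differentiable (by simp) p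
  rw [fderiv_clm_apply hd (by fun_prop), fderiv_clm_apply hd (by fun_prop)]
  have := (h.1.contDiffAt (x := p)).isSymmSndFDerivAt
    (by rw [minSmoothness_of_isRCLikeNormedField]; exact WithTop.coe_le_coe.2 le_top)
  simpa using this w v

end Test

/-! ### The radial profile of the Helmholtz kernel -/

/-- The radial profile `-exp(iατ) / (4πτ)`. -/
def helm (α : ℂ) (τ : ℝ) : ℂ :=
  -Complex.exp (Complex.I * α * (τ : ℂ)) / (4 * (Real.pi : ℂ) * (τ : ℂ))

/-- The derivative of `helm` divided by `τ`. -/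
def helmQ (α : ℂ) (τ : ℝ) : ℂ := (Complex.I * α / τ - 1 / (τ : ℂ) ^ 2) * helm α τ

/-- The derivative of `helmQ`. -/
def helmQ' (α : ℂ) (τ : ℝ) : ℂ :=
  (-α ^ 2 / τ - 3 * Complex.I * α / (τ : ℂ) ^ 2 + 3 / (τ : ℂ) ^ 3) * helm α τ

theorem hasDerivAt_helm (α : ℂ) {τ : ℝ} (hτ : τ ≠ 0) :
    HasDerivAt (helm α) (τ * helmQ α τ) τ := by
  have hτ' : (τ : ℂ) ≠ 0 := by exact_mod_cast hτ
  have hπ : (Real.pi : ℂ) ≠ 0 := by exact_mod_cast Real.pi_ne_zero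
  have h1 : HasDerivAt (fun τ : ℝ => (τ : ℂ)) 1 τ := Complex.ofRealCLM.hasDerivAt
  have h2 := ((h1.const_mul (Complex.I * α)).cexp.neg).div (h1.const_mul (4 * (Real.pi : ℂ)))
    (by simp [hτ, Real.pi_ne_zero])
  refine h2.congr_deriv ?_
  simp only [helmQ, helm, Pi.neg_apply]
  field_simp
  ring

theorem hasDerivAt_helmQ (α : ℂ) {τ : ℝ} (hτ : τ ≠ 0) :
    HasDerivAt (helmQ α) (helmQ' α τ) τ := by
  have hτ' : (τ : ℂ) ≠ 0 := by exact_mod_cast hτ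
  have h1 : HasDerivAt (fun τ : ℝ => (τ : ℂ)) 1 τ := Complex.ofRealCLM.hasDerivAt
  have h2 := (((hasDerivAt_const τ (Complex.I * α)).div h1 hτ').sub
    ((hasDerivAt_const τ (1 : ℂ)).div (h1.pow 2) (pow_ne_zero 2 hτ'))).mul (hasDerivAt_helm α hτ)
  refine h2.congr_deriv ?_
  simp only [helmQ', helmQ, Pi.sub_apply, Pi.div_apply, Pi.pow_apply]
  field_simp
  ring_nf
  simp only [Complex.I_sq]
  ring

/-- If τ² = |x|² + η², the left side is the divergence of x·`helmQ`(τ), that is, the Laplacian of x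
↦ `helm`(τ). The radial Helmholtz equation 3Q + τQ' = −α²h would need |x|² = τ²; the last term is
the defect, which concentrates at the origin as η → 0. -/
theorem helm_laplace (α : ℂ) (η : ℝ) {τ : ℝ} (hτ : τ ≠ 0) :
    3 * helmQ α τ + ((τ : ℂ) ^ 2 - η ^ 2) / τ * helmQ' α τ
      = -(α ^ 2 * helm α τ) - η ^ 2 / τ * helmQ' α τ := by
  have hτ' : (τ : ℂ) ≠ 0 := by exact_mod_cast hτ
  simp only [helmQ', helmQ]
  field_simp
  ring

theorem norm_helm_le (α : ℂ) {τ S : ℝ} (h0 : 0 < τ) (h1 : τ ≤ S) :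
    ‖helm α τ‖ ≤ Real.exp (‖α‖ * S) / τ := by
  have h2 : ‖Complex.exp (Complex.I * α * (τ : ℂ))‖ ≤ Real.exp (‖α‖ * S) := by
    rw [Complex.norm_exp]
    apply Real.exp_le_exp.2
    calc (Complex.I * α * (τ : ℂ)).re ≤ ‖Complex.I * α * (τ : ℂ)‖ := Complex.re_le_norm _
      _ = ‖α‖ * τ := by simp [abs_of_pos h0]
      _ ≤ _ := by gcongr
  have h3 : ‖(4 * (Real.pi : ℂ) * (τ : ℂ))‖ = 4 * Real.pi * τ := by
    simp [abs_of_pos h0, abs_of_pos Real.pi_pos]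
  rw [helm, norm_div, norm_neg, h3]
  gcongr
  nlinarith [Real.pi_gt_three]

/-- A bound for the kernels on a ball. -/
def helmBound (α : ℂ) (S : ℝ) : ℝ := (‖α‖ * S + S + 1) * Real.exp (‖α‖ * S)

theorem helmBound_nonneg (α : ℂ) {S : ℝ} (hS : 0 ≤ S) : 0 ≤ helmBound α S := by
  unfold helmBound; positivity

/-- The bound is in terms of r and not of τ, so that with r = |x| one majorant serves all
regularized radii τ ≥ |x|. The power r⁻² is weaker than needed here, but is shared with the gradient
and is still locally integrable in ℝ³. -/
theorem norm_helm_le' (α : ℂ) {r τ S : ℝ} (hr : 0 < r) (h0 : r ≤ τ) (h1 : τ ≤ S) :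
    ‖helm α τ‖ ≤ helmBound α S * (r ^ 2)⁻¹ := by
  have hτ : 0 < τ := hr.trans_le h0
  refine (norm_helm_le α hτ h1).trans ?_
  calc Real.exp (‖α‖ * S) / τ ≤ Real.exp (‖α‖ * S) / r := by gcongr
    _ = (r * Real.exp (‖α‖ * S)) * (r ^ 2)⁻¹ := by field_simp
    _ ≤ helmBound α S * (r ^ 2)⁻¹ := by
      unfold helmBound
      gcongr
      have : 0 ≤ ‖α‖ * S := mul_nonneg (norm_nonneg _) (hτ.le.trans h1)
      linarith

theorem norm_helmQ_le (α : ℂ) {r τ S : ℝ} (hr : 0 < r) (h0 : r ≤ τ) (h1 : τ ≤ S) :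
    r * ‖helmQ α τ‖ ≤ helmBound α S * (r ^ 2)⁻¹ := by
  have hτ : 0 < τ := hr.trans_le h0
  have h2 : ‖Complex.I * α / τ - 1 / (τ : ℂ) ^ 2‖ ≤ ‖α‖ / τ + 1 / τ ^ 2 := by
    refine (norm_sub_le _ _).trans (le_of_eq ?_)
    simp [abs_of_pos hτ]
  have hα := norm_nonneg α
  rw [helmQ, norm_mul]
  calc r * (‖Complex.I * α / τ - 1 / (τ : ℂ) ^ 2‖ * ‖helm α τ‖)
      ≤ τ * ((‖α‖ / τ + 1 / τ ^ 2) * (Real.exp (‖α‖ * S) / τ)) := by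
        gcongr
        exact norm_helm_le α hτ h1
    _ = (‖α‖ * τ + 1) * Real.exp (‖α‖ * S) * (τ ^ 2)⁻¹ := by field_simp
    _ ≤ helmBound α S * (r ^ 2)⁻¹ := by
      unfold helmBound
      have : ‖α‖ * τ ≤ ‖α‖ * S := by gcongr
      have hS : 0 ≤ S := hτ.le.trans h1
      gcongr
      linarith

/-! ### Regularization of the radius -/

/-- The regularized radius `√(|x|² + η²)`. -/
def regRadius (η : ℝ) (x : E3) : ℝ := √(‖x‖ ^ 2 + η ^ 2)

theorem regRadius_sq (η : ℝ) (x : E3) : regRadius η x ^ 2 = ‖x‖ ^ 2 + η ^ 2 :=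
  Real.sq_sqrt (by positivity)

theorem regRadius_pos {η : ℝ} (hη : η ≠ 0) (x : E3) : 0 < regRadius η x :=
  Real.sqrt_pos.2 (by positivity)

theorem norm_le_regRadius (η : ℝ) (x : E3) : ‖x‖ ≤ regRadius η x :=
  Real.le_sqrt_of_sq_le (by nlinarith [sq_nonneg η])

theorem regRadius_le {η : ℝ} (h0 : 0 ≤ η) (x : E3) : regRadius η x ≤ ‖x‖ + η :=
  Real.sqrt_le_iff.2 ⟨by positivity, by nlinarith [norm_nonneg x]⟩

theorem continuous_regRadius (η : ℝ) : Continuous (regRadius η) := by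
  unfold regRadius; fun_prop

theorem tendsto_regRadius (x : E3) : Tendsto (fun η => regRadius η x) (𝓝[>] 0) (𝓝 ‖x‖) := by
  have : Continuous (fun η => regRadius η x) := by unfold regRadius; fun_prop
  have h := this.tendsto 0
  simp only [regRadius, ne_eq, OfNat.ofNat_ne_zero, not_false_eq_true, zero_pow, add_zero,
    norm_nonneg, Real.sqrt_sq] at h
  exact h.mono_left nhdsWithin_le_nhds

theorem hasFDerivAt_comp_regRadius {η : ℝ} (hη : η ≠ 0) {G : ℝ → ℂ} {G' : ℂ} (x : E3)
    (hG : HasDerivAt G G' (regRadius η x)) :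
    ∃ L : E3 →L[ℝ] ℂ, HasFDerivAt (fun y => G (regRadius η y)) L x ∧
      ∀ k, L (dirE3 k) = (x k : ℂ) / regRadius η x * G' := by
  have h1 : HasFDerivAt (fun y : E3 => ‖y‖ ^ 2 + η ^ 2) (2 • (innerSL ℝ x)) x :=
    ((hasStrictFDerivAt_norm_sq x).hasFDerivAt).add_const _
  have hpos : ‖x‖ ^ 2 + η ^ 2 ≠ 0 := by positivity
  have h2 := h1.sqrt hpos
  have h3 := hG.hasFDerivAt.comp x h2
  refine ⟨_, h3, fun k => ?_⟩
  have hk : inner ℝ x (dirE3 k) = x k := by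
    simp [dirE3, EuclideanSpace.inner_single_right]
  have hρ : (regRadius η x : ℂ) ≠ 0 := by exact_mod_cast (regRadius_pos hη x).ne'
  simp [hk]
  rw [show √(‖x‖ ^ 2 + η ^ 2) = regRadius η x from rfl]
  field_simp

theorem fderiv_comp_regRadius {η : ℝ} (hη : η ≠ 0) {G G' : ℝ → ℂ}
    (hG : ∀ τ, τ ≠ 0 → HasDerivAt G (G' τ) τ) :
    Differentiable ℝ (fun y => G (regRadius η y)) ∧ ∀ x k,
      fderiv ℝ (fun y => G (regRadius η y)) x (dirE3 k)
        = (x k : ℂ) / regRadius η x * G' (regRadius η x) := by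
  refine ⟨fun x => ?_, fun x k => ?_⟩
  · obtain ⟨L, h, -⟩ := hasFDerivAt_comp_regRadius hη x (hG _ (regRadius_pos hη x).ne')
    exact h.differentiableAt
  · obtain ⟨L, h, h'⟩ := hasFDerivAt_comp_regRadius hη x (hG _ (regRadius_pos hη x).ne')
    rw [h.fderiv, h' k]

theorem continuousOn_helm (α : ℂ) : ContinuousOn (helm α) {0}ᶜ := fun _ hτ =>
  (hasDerivAt_helm α hτ).continuousAt.continuousWithinAt

theorem continuousOn_helmQ (α : ℂ) : ContinuousOn (helmQ α) {0}ᶜ := fun _ hτ =>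
  (hasDerivAt_helmQ α hτ).continuousAt.continuousWithinAt

theorem continuousOn_helmQ' (α : ℂ) : ContinuousOn (helmQ' α) {0}ᶜ := by
  have h : ContinuousOn (fun τ : ℝ => (τ : ℂ)) {0}ᶜ := Complex.continuous_ofReal.continuousOn
  have h0 : ∀ τ ∈ ({0}ᶜ : Set ℝ), (τ : ℂ) ≠ 0 := fun τ hτ => by exact_mod_cast hτ
  unfold helmQ'
  refine ContinuousOn.mul ((ContinuousOn.sub ?_ ?_).add ?_) (continuousOn_helm α)
  · exact continuousOn_const.div h h0
  · exact continuousOn_const.div (h.pow 2) fun τ hτ => pow_ne_zero 2 (h0 τ hτ)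
  · exact continuousOn_const.div (h.pow 3) fun τ hτ => pow_ne_zero 3 (h0 τ hτ)

theorem continuous_comp_regRadius {η : ℝ} (hη : η ≠ 0) {G : ℝ → ℂ} (hG : ContinuousOn G {0}ᶜ) :
    Continuous fun x => G (regRadius η x) :=
  hG.comp_continuous (continuous_regRadius η) fun x => (regRadius_pos hη x).ne'

theorem continuous_coord (k : Fin 3) : Continuous fun x : E3 => ((x k : ℝ) : ℂ) :=
  Complex.continuous_ofReal.comp (EuclideanSpace.proj (𝕜 := ℝ) k).continuous

theorem hasFDerivAt_coord (k : Fin 3) (x : E3) :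
    HasFDerivAt (fun x : E3 => ((x k : ℝ) : ℂ))
      (Complex.ofRealCLM.comp (EuclideanSpace.proj (𝕜 := ℝ) k)) x :=
  (Complex.ofRealCLM.comp (EuclideanSpace.proj (𝕜 := ℝ) k)).hasFDerivAt

theorem integrable_test_mul {φ G : E3 → ℂ} (hφ : IsTest φ) (hG : Continuous G) :
    Integrable fun x => φ x * G x :=
  (hφ.continuous.mul hG).integrable_of_hasCompactSupport hφ.2.mul_right

theorem integral_test_mul_fderiv {φ G : E3 → ℂ} (hφ : IsTest φ) (hG : Differentiable ℝ G) (v : E3)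
    (hG' : Continuous fun x => fderiv ℝ G x v) :
    ∫ x, φ x * fderiv ℝ G x v = -∫ x, fderiv ℝ φ x v * G x :=
  integral_mul_fderiv_eq_neg_fderiv_mul_of_integrable
    (integrable_test_mul (hφ.fderiv_apply v) hG.continuous)
    (integrable_test_mul hφ hG') (integrable_test_mul hφ hG.continuous)
    (fun x _ => hφ.differentiable x) (fun x _ => hG x)

theorem integral_fderiv_mul_helm_reg (α : ℂ) {η : ℝ} (hη : η ≠ 0) {φ : E3 → ℂ} (hφ : IsTest φ)
    (k : Fin 3) :
    ∫ x, fderiv ℝ φ x (dirE3 k) * helm α (regRadius η x)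
      = -∫ x, φ x * (x k * helmQ α (regRadius η x)) := by
  obtain ⟨hd, hf⟩ := fderiv_comp_regRadius hη (fun τ hτ => hasDerivAt_helm α hτ)
  have he : ∀ x, fderiv ℝ (fun y => helm α (regRadius η y)) x (dirE3 k)
      = x k * helmQ α (regRadius η x) := fun x => by
    have hρ : (regRadius η x : ℂ) ≠ 0 := by exact_mod_cast (regRadius_pos hη x).ne'
    rw [hf]; field_simp
  have hc : Continuous fun x : E3 => (x k : ℂ) * helmQ α (regRadius η x) :=
    (continuous_coord k).mul (continuous_comp_regRadius hη (continuousOn_helmQ α))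
  have := integral_test_mul_fderiv hφ hd (dirE3 k) (by simpa only [he] using hc)
  simp only [he] at this
  rw [this, neg_neg]

/-- Integration by parts moves the derivatives onto x·`helmQ`(ρ), whose divergence is given by
`helm_laplace`. The second term on the right is the one that tends to a delta function. -/
theorem sum_integral_fderiv_mul_helmQ_reg (α : ℂ) {η : ℝ} (hη : η ≠ 0) {φ : E3 → ℂ}
    (hφ : IsTest φ) :
    ∑ k, ∫ x, fderiv ℝ φ x (dirE3 k) * (x k * helmQ α (regRadius η x))
      = α ^ 2 * (∫ x, φ x * helm α (regRadius η x))
        + ∫ x, φ x * (η ^ 2 / regRadius η x * helmQ' α (regRadius η x)) := by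
  obtain ⟨hd, hf⟩ := fderiv_comp_regRadius hη (fun τ hτ => hasDerivAt_helmQ α hτ)
  have he : ∀ k x, fderiv ℝ (fun y : E3 => (y k : ℂ) * helmQ α (regRadius η y)) x (dirE3 k)
      = helmQ α (regRadius η x) + (x k : ℂ) ^ 2 / regRadius η x * helmQ' α (regRadius η x) := by
    intro k x
    rw [((hasFDerivAt_coord k x).fun_mul (hd x).hasFDerivAt).fderiv]
    have h1 : (dirE3 k) k = 1 := by simp [dirE3]
    simp [hf, h1]
    ring
  have hcρ : Continuous fun x => (regRadius η x : ℂ) :=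
    Complex.continuous_ofReal.comp (continuous_regRadius η)
  have hρ0 : ∀ x, (regRadius η x : ℂ) ≠ 0 := fun x => by
    exact_mod_cast (regRadius_pos hη x).ne'
  have hc0 := continuous_comp_regRadius hη (continuousOn_helm α)
  have hc1 := continuous_comp_regRadius hη (continuousOn_helmQ α)
  have hc2 := continuous_comp_regRadius hη (continuousOn_helmQ' α)
  have hc : ∀ k, Continuous fun x : E3 =>
      helmQ α (regRadius η x) + (x k : ℂ) ^ 2 / regRadius η x * helmQ' α (regRadius η x) :=
    fun k => hc1.add ((((continuous_coord k).pow 2).div hcρ hρ0).mul hc2)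
  have hc3 : Continuous fun x : E3 => (η : ℂ) ^ 2 / regRadius η x * helmQ' α (regRadius η x) :=
    (continuous_const.div hcρ hρ0).mul hc2
  have hk : ∀ k, ∫ x, fderiv ℝ φ x (dirE3 k) * (x k * helmQ α (regRadius η x)) =
      -∫ x, φ x * (helmQ α (regRadius η x) +
        (x k : ℂ) ^ 2 / regRadius η x * helmQ' α (regRadius η x)) := by
    intro k
    have := integral_test_mul_fderiv hφ
      (fun x => ((hasFDerivAt_coord k x).fun_mul (hd x).hasFDerivAt).differentiableAt) (dirE3 k)
      (by simpa only [he] using hc k)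
    simp only [he] at this
    rw [this, neg_neg]
  simp only [hk]
  rw [Finset.sum_neg_distrib, ← integral_finsetSum _ fun k _ => integrable_test_mul hφ (hc k),
    ← integral_neg, ← integral_const_mul, ← integral_add
      ((integrable_test_mul hφ hc0).const_mul _)
      (integrable_test_mul hφ hc3)]
  congr 1
  ext x
  have hl := helm_laplace α η (regRadius_pos hη x).ne'
  have hs : ((regRadius η x : ℂ)) ^ 2 - η ^ 2 = ∑ k, (x k : ℂ) ^ 2 := by
    have h1 := regRadius_sq η x
    rw [EuclideanSpace.norm_sq_eq] at h1
    have h2 : (regRadius η x) ^ 2 - η ^ 2 = ∑ k, (x k) ^ 2 := by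
      rw [h1]; simp
    exact_mod_cast h2
  rw [hs] at hl
  simp only [Fin.sum_univ_three] at hl ⊢
  linear_combination (-φ x) * hl

/-! ### Limits of regularized integrals -/

theorem finrank_E3 : Module.finrank ℝ E3 = 3 := by simp

/-- In polar coordinates the Jacobian s² cancels the singularity. -/
theorem integrableOn_inv_norm_sq (R : ℝ) :
    IntegrableOn (fun x : E3 => (‖x‖ ^ 2)⁻¹) (Metric.closedBall 0 R) := by
  have h : IntegrableOn (fun x : E3 => (‖x‖ ^ 2)⁻¹) (Metric.ball 0 (R + 1)) := by
    rw [integrableOn_fun_norm_addHaar volume (f := fun s : ℝ => (s ^ 2)⁻¹), finrank_E3]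
    refine ((integrableOn_const (C := (1 : ℝ)) (s := Set.Ioo 0 (R + 1)) (by simp)
      (by simp))).congr_fun (fun y hy => ?_) measurableSet_Ioo
    have : y ≠ 0 := hy.1.ne'
    simp [this]
  exact h.mono_set (Metric.closedBall_subset_ball (by linarith))

theorem ae_ne_zero_E3 : ∀ᵐ x : E3, x ≠ 0 := by
  simp [ae_iff, measure_singleton]

theorem HasCompactSupport.exists_radius {X : Type*} [NormedAddCommGroup X] {φ : X → ℂ}
    (h : HasCompactSupport φ) : ∃ R : ℝ, 0 < R ∧ ∀ x, R < ‖x‖ → φ x = 0 := by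
  obtain ⟨R, hR⟩ := h.isCompact.isBounded.subset_closedBall 0
  refine ⟨max R 1, by positivity, fun x hx => image_eq_zero_of_notMem_tsupport fun hmem => ?_⟩
  have := hR hmem
  simp only [mem_closedBall_zero_iff] at this
  exact absurd (this.trans (le_max_left R 1)) (not_le.2 hx)

theorem HasCompactSupport.exists_norm_le {X : Type*} [TopologicalSpace X] {φ : X → ℂ}
    (h : HasCompactSupport φ) (hc : Continuous φ) : ∃ M : ℝ, 0 ≤ M ∧ ∀ x, ‖φ x‖ ≤ M := by
  obtain ⟨M, hM⟩ := hc.bounded_above_of_compact_support h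
  exact ⟨max M 0, le_max_right _ _, fun x => (hM x).trans (le_max_left _ _)⟩

/-- Dominated convergence with majorant C|x|⁻² on a ball containing the support. The origin, where
neither the bound nor the limit is assumed, is a null set. -/
theorem tendsto_integral_test_mul {φ : E3 → ℂ} (hφ : IsTest φ) {G : ℝ → E3 → ℂ} {G0 : E3 → ℂ}
    (hG : ∀ η > 0, Continuous (G η))
    (hb : ∀ R > 0, ∃ C ≥ 0, ∀ η > 0, η ≤ 1 → ∀ x, x ≠ 0 → ‖x‖ ≤ R → ‖G η x‖ ≤ C * (‖x‖ ^ 2)⁻¹)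
    (hlim : ∀ x, x ≠ 0 → Tendsto (fun η => G η x) (𝓝[>] 0) (𝓝 (G0 x))) :
    Tendsto (fun η => ∫ x, φ x * G η x) (𝓝[>] 0) (𝓝 (∫ x, φ x * G0 x)) := by
  obtain ⟨R, hR, hsupp⟩ := HasCompactSupport.exists_radius hφ.2
  obtain ⟨M, hM0, hM⟩ := HasCompactSupport.exists_norm_le hφ.2 hφ.continuous
  obtain ⟨C, hC0, hC⟩ := hb R hR
  have hpos : ∀ᶠ η : ℝ in 𝓝[>] 0, 0 < η ∧ η ≤ 1 := by
    filter_upwards [Ioc_mem_nhdsGT (zero_lt_one' ℝ)] with η hη using hη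
  refine tendsto_integral_filter_of_dominated_convergence
    ((Metric.closedBall (0 : E3) R).indicator fun x => M * C * (‖x‖ ^ 2)⁻¹) ?_ ?_ ?_ ?_
  · filter_upwards [hpos] with η hη
    exact (hφ.continuous.mul (hG η hη.1)).aestronglyMeasurable
  · filter_upwards [hpos] with η hη
    filter_upwards [ae_ne_zero_E3] with x hx
    by_cases hxR : ‖x‖ ≤ R
    · rw [Set.indicator_of_mem (by simpa using hxR), norm_mul, mul_assoc]
      exact mul_le_mul (hM x) (hC η hη.1 hη.2 x hx hxR) (norm_nonneg _) hM0
    · rw [hsupp x (not_le.1 hxR), Set.indicator_of_notMem (by simpa using hxR)]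
      simp
  · rw [integrable_indicator_iff measurableSet_closedBall]
    exact (integrableOn_inv_norm_sq R).const_mul _
  · filter_upwards [ae_ne_zero_E3] with x hx
    exact (hlim x hx).const_mul _

theorem Theta_eq_helm (α : ℂ) (x : E3) : Theta α x = helm α ‖x‖ := rfl

theorem tendsto_integral_helm_reg (α : ℂ) {φ : E3 → ℂ} (hφ : IsTest φ) :
    Tendsto (fun η => ∫ x, φ x * helm α (regRadius η x)) (𝓝[>] 0) (𝓝 (∫ x, φ x * helm α ‖x‖)) := by
  refine tendsto_integral_test_mul hφ
    (fun η hη => continuous_comp_regRadius hη.ne' (continuousOn_helm α)) (fun R hR => ?_)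
    (fun x hx => ?_)
  · refine ⟨helmBound α (R + 1), helmBound_nonneg _ (by linarith), fun η hη h1 x hx hxR => ?_⟩
    exact norm_helm_le' α (norm_pos_iff.2 hx) (norm_le_regRadius η x)
      ((regRadius_le hη.le x).trans (add_le_add hxR h1))
  · exact (hasDerivAt_helm α (norm_ne_zero_iff.2 hx)).continuousAt.tendsto.comp
      (tendsto_regRadius x)

theorem norm_coord_le (x : E3) (k : Fin 3) : ‖((x k : ℝ) : ℂ)‖ ≤ ‖x‖ := by
  simpa using PiLp.norm_apply_le x k

theorem norm_coord_mul_helmQ_le (α : ℂ) {x : E3} {τ S : ℝ} (hx : x ≠ 0) (h0 : ‖x‖ ≤ τ)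
    (h1 : τ ≤ S) (k : Fin 3) : ‖(x k : ℂ) * helmQ α τ‖ ≤ helmBound α S * (‖x‖ ^ 2)⁻¹ := by
  rw [norm_mul]
  exact (mul_le_mul_of_nonneg_right (norm_coord_le x k) (norm_nonneg _)).trans
    (norm_helmQ_le α (norm_pos_iff.2 hx) h0 h1)

theorem tendsto_integral_helmQ_reg (α : ℂ) {φ : E3 → ℂ} (hφ : IsTest φ) (k : Fin 3) :
    Tendsto (fun η => ∫ x, φ x * (x k * helmQ α (regRadius η x))) (𝓝[>] 0)
      (𝓝 (∫ x, φ x * (x k * helmQ α ‖x‖))) := by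
  refine tendsto_integral_test_mul hφ
    (fun η hη => (continuous_coord k).mul (continuous_comp_regRadius hη.ne' (continuousOn_helmQ α)))
    (fun R hR => ?_) (fun x hx => ?_)
  · refine ⟨helmBound α (R + 1), helmBound_nonneg _ (by linarith), fun η hη h1 x hx hxR => ?_⟩
    exact norm_coord_mul_helmQ_le α hx (norm_le_regRadius η x)
      ((regRadius_le hη.le x).trans (add_le_add hxR h1)) k
  · exact ((hasDerivAt_helmQ α (norm_ne_zero_iff.2 hx)).continuousAt.tendsto.comp
      (tendsto_regRadius x)).const_mul _

/-! ### Total mass of the regularized delta function -/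

theorem regRadius_one_pow_eq (x : E3) :
    (regRadius 1 x ^ 5)⁻¹ = (1 + ‖x‖ ^ 2) ^ (-(5 : ℝ) / 2) := by
  have h : (0 : ℝ) ≤ 1 + ‖x‖ ^ 2 := by positivity
  rw [neg_div, Real.rpow_neg h, regRadius, Real.sqrt_eq_rpow, ← Real.rpow_natCast,
    ← Real.rpow_mul (by positivity)]
  norm_num [add_comm]

theorem integrable_regRadius_one_pow : Integrable fun x : E3 => (regRadius 1 x ^ 5)⁻¹ := by
  simp only [regRadius_one_pow_eq]
  exact integrable_rpow_neg_one_add_norm_sq (by rw [finrank_E3]; norm_num)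

/-- An explicit primitive is (s/√(s² + 1))³/3, which rises from 0 to 1/3. -/
theorem integral_Ioi_sq_div_sqrt :
    ∫ s in Set.Ioi (0 : ℝ), s ^ 2 * (√(s ^ 2 + 1) ^ 5)⁻¹ = 1 / 3 := by
  have hpos : ∀ s : ℝ, 0 < s ^ 2 + 1 := fun s => by positivity
  have hsq : ∀ s : ℝ, √(s ^ 2 + 1) ^ 2 = s ^ 2 + 1 := fun s => Real.sq_sqrt (hpos s).le
  have hd : ∀ s : ℝ, HasDerivAt (fun s : ℝ => (s / √(s ^ 2 + 1)) ^ 3 / 3)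
      (s ^ 2 * (√(s ^ 2 + 1) ^ 5)⁻¹) s := by
    intro s
    have h1 : HasDerivAt (fun s : ℝ => √(s ^ 2 + 1)) (s / √(s ^ 2 + 1)) s := by
      have := (((hasDerivAt_id s).pow 2).add_const (1 : ℝ)).sqrt (hpos s).ne'
      refine this.congr_deriv ?_
      simp
      field_simp
    have h0 : √(s ^ 2 + 1) ≠ 0 := (Real.sqrt_pos.2 (hpos s)).ne'
    have h2 := (((hasDerivAt_id s).div h1 h0).pow 3).div_const 3
    refine h2.congr_deriv ?_
    have h3 := hsq s
    simp only [id, Pi.div_apply]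
    generalize √(s ^ 2 + 1) = u at h0 h3 ⊢
    have h4 : 1 * u - s * (s / u) = 1 / u := by
      field_simp
      linarith
    rw [h4]
    push_cast
    field_simp
  have hlim : Tendsto (fun s : ℝ => (s / √(s ^ 2 + 1)) ^ 3 / 3) atTop (𝓝 (1 / 3)) := by
    have h1 : Tendsto (fun s : ℝ => √(1 - (s ^ 2 + 1)⁻¹)) atTop (𝓝 (√(1 - 0))) := by
      refine (tendsto_const_nhds.sub ?_).sqrt
      exact tendsto_inv_atTop_zero.comp
        (tendsto_atTop_add_const_right _ _ (tendsto_pow_atTop two_ne_zero))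
    have h2 : Tendsto (fun s : ℝ => s / √(s ^ 2 + 1)) atTop (𝓝 1) := by
      rw [sub_zero, Real.sqrt_one] at h1
      refine h1.congr' ?_
      filter_upwards [eventually_ge_atTop 0] with s hs
      rw [show 1 - (s ^ 2 + 1)⁻¹ = s ^ 2 / (s ^ 2 + 1) by field_simp [(hpos s).ne']; ring,
        Real.sqrt_div (sq_nonneg s), Real.sqrt_sq hs]
    simpa using (h2.pow 3).div_const 3
  have := integral_Ioi_of_hasDerivAt_of_nonneg' (a := 0) (fun s _ => hd s)
    (fun s _ => by positivity) hlim
  simpa using this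

theorem integral_regRadius_one_pow :
    ∫ x : E3, (regRadius 1 x ^ 5)⁻¹ = 4 * Real.pi / 3 := by
  have h := integral_fun_norm_addHaar (volume : Measure E3) (fun s => (√(s ^ 2 + 1) ^ 5)⁻¹)
  have hv : (volume : Measure E3).real (Metric.ball 0 1) = 4 * Real.pi / 3 := by
    rw [Measure.real, EuclideanSpace.volume_ball_fin_three]
    rw [ENNReal.toReal_mul, ENNReal.toReal_pow, ENNReal.toReal_ofReal zero_le_one,
      ENNReal.toReal_ofReal (by positivity)]
    ring
  rw [finrank_E3, hv] at h
  have h2 := integral_Ioi_sq_div_sqrt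
  simp only [smul_eq_mul, show 3 - 1 = 2 from rfl, nsmul_eq_mul] at h
  rw [h2] at h
  simp only [regRadius, one_pow]
  rw [h]
  push_cast
  ring

/-- The regular part of the regularized delta function. -/
def helmP (α : ℂ) (τ : ℝ) : ℂ :=
  Complex.exp (Complex.I * α * (τ : ℂ)) * (3 - 3 * Complex.I * α * τ - α ^ 2 * τ ^ 2)

theorem continuous_helmP (α : ℂ) : Continuous (helmP α) := by
  unfold helmP; fun_prop

theorem helmQ'_eq_helmP (α : ℂ) {τ : ℝ} (hτ : τ ≠ 0) :
    helmQ' α τ = -helmP α τ / (4 * Real.pi * (τ : ℂ) ^ 4) := by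
  have hτ' : (τ : ℂ) ≠ 0 := by exact_mod_cast hτ
  have hπ : (Real.pi : ℂ) ≠ 0 := by exact_mod_cast Real.pi_ne_zero
  simp only [helmQ', helmP, helm]
  field_simp
  ring

theorem regRadius_smul {η : ℝ} (hη : 0 < η) (y : E3) :
    regRadius η (η • y) = η * regRadius 1 y := by
  rw [regRadius, regRadius, norm_smul, Real.norm_of_nonneg hη.le,
    show (η * ‖y‖) ^ 2 + η ^ 2 = η ^ 2 * (‖y‖ ^ 2 + 1 ^ 2) by ring, Real.sqrt_mul (sq_nonneg η),
    Real.sqrt_sq hη.le]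

/-- After the substitution x = ηy all powers of η cancel: the integrand becomes
−φ(ηy)·`helmP`(ηρ₁)/(4πρ₁⁵) with ρ₁ = √(|y|² + 1). At η = 0 the factor `helmP` equals 3 and ρ₁⁻⁵ has
integral 4π/3, so the constants multiply to −1. -/
theorem tendsto_integral_delta_reg (α : ℂ) {φ : E3 → ℂ} (hφ : IsTest φ) :
    Tendsto (fun η : ℝ => ∫ x, φ x * ((η : ℂ) ^ 2 / regRadius η x * helmQ' α (regRadius η x)))
      (𝓝[>] 0) (𝓝 (-φ 0)) := by
  have hπ : (Real.pi : ℂ) ≠ 0 := by exact_mod_cast Real.pi_ne_zero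
  have hpos : ∀ᶠ η : ℝ in 𝓝[>] 0, 0 < η ∧ η ≤ 1 := by
    filter_upwards [Ioc_mem_nhdsGT (zero_lt_one' ℝ)] with η hη using hη
  let F : ℝ → E3 → ℂ := fun η y => φ (η • y) * helmP α (η * regRadius 1 y) *
    (-(1 / (4 * Real.pi)) * ((regRadius 1 y ^ 5)⁻¹ : ℝ))
  have hF : ∀ᶠ η : ℝ in 𝓝[>] 0, ∫ y, F η y =
      ∫ x, φ x * ((η : ℂ) ^ 2 / regRadius η x * helmQ' α (regRadius η x)) := by
    filter_upwards [hpos] with η hη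
    have hη0 : (η : ℂ) ≠ 0 := by exact_mod_cast hη.1.ne'
    have h := Measure.integral_comp_smul_of_nonneg (volume : Measure E3)
      (fun x => φ x * ((η : ℂ) ^ 2 / regRadius η x * helmQ' α (regRadius η x))) η (hR := hη.1.le)
    rw [finrank_E3] at h
    have h2 : ∀ y, F η y = (η : ℂ) ^ 3 * (φ (η • y) * ((η : ℂ) ^ 2 / regRadius η (η • y)
        * helmQ' α (regRadius η (η • y)))) := by
      intro y
      have hσ : (regRadius 1 y : ℂ) ≠ 0 := by exact_mod_cast (regRadius_pos one_ne_zero y).ne'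
      rw [regRadius_smul hη.1, helmQ'_eq_helmP α (mul_pos hη.1 (regRadius_pos one_ne_zero y)).ne']
      simp only [F]
      push_cast
      field_simp
    simp only [h2]
    rw [integral_const_mul, h, Complex.real_smul]
    push_cast
    field_simp
  refine Tendsto.congr' hF ?_
  have hval : ∫ y : E3, φ 0 * helmP α 0 * (-(1 / (4 * Real.pi)) * ((regRadius 1 y ^ 5)⁻¹ : ℝ))
      = -φ 0 := by
    rw [integral_const_mul, integral_const_mul, integral_complex_ofReal,
      integral_regRadius_one_pow]
    simp [helmP]
    field_simp
  rw [← hval]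
  obtain ⟨R, hR, hsupp⟩ := HasCompactSupport.exists_radius hφ.2
  obtain ⟨M, hM0, hM⟩ := HasCompactSupport.exists_norm_le hφ.2 hφ.continuous
  -- Where φ(ηy) does not vanish, |ηy| ≤ R; together with η ≤ 1 this puts ηρ₁, the regularized
  -- radius at ηy, into [0, R + 1].
  obtain ⟨C, hC⟩ := (isCompact_Icc (a := (0 : ℝ)) (b := R + 1)).exists_bound_of_continuousOn
    (continuous_helmP α).continuousOn
  have hC0 : 0 ≤ C := (norm_nonneg _).trans (hC 0 ⟨le_rfl, by linarith⟩)
  refine tendsto_integral_filter_of_dominated_convergence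
    (fun y => M * C * (1 / (4 * Real.pi) * (regRadius 1 y ^ 5)⁻¹)) ?_ ?_ ?_ ?_
  · filter_upwards with η
    refine Continuous.aestronglyMeasurable (Continuous.mul (Continuous.mul ?_ ?_) ?_)
    · exact hφ.continuous.comp (by fun_prop)
    · exact (continuous_helmP α).comp (continuous_const.mul (continuous_regRadius 1))
    · exact continuous_const.mul (Complex.continuous_ofReal.comp
        (((continuous_regRadius 1).pow 5).inv₀ fun y =>
          pow_ne_zero 5 (regRadius_pos one_ne_zero y).ne'))
  · filter_upwards [hpos] with η hη
    filter_upwards with y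
    have hσ := regRadius_pos one_ne_zero y
    simp only [F]
    rw [norm_mul, norm_mul]
    have h3 : ‖(-(1 / (4 * Real.pi)) * ((regRadius 1 y ^ 5)⁻¹ : ℝ) : ℂ)‖
        = 1 / (4 * Real.pi) * (regRadius 1 y ^ 5)⁻¹ := by
      simp [abs_of_pos hσ, abs_of_pos Real.pi_pos]
    rw [h3]
    have h4 : (0 : ℝ) ≤ 1 / (4 * Real.pi) * (regRadius 1 y ^ 5)⁻¹ := by positivity
    refine mul_le_mul_of_nonneg_right ?_ h4
    by_cases hy : ‖η • y‖ ≤ R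
    · refine mul_le_mul (hM _) (hC _ ⟨(mul_pos hη.1 hσ).le, ?_⟩) (norm_nonneg _) hM0
      rw [← regRadius_smul hη.1]
      exact (regRadius_le hη.1.le _).trans (add_le_add hy hη.2)
    · rw [hsupp _ (not_le.1 hy)]
      simpa using mul_nonneg hM0 hC0
  · exact (integrable_regRadius_one_pow.const_mul _).const_mul _
  · filter_upwards with y
    have h1 : Continuous fun η : ℝ => F η y := by
      refine Continuous.mul (Continuous.mul ?_ ?_) continuous_const
      · exact hφ.continuous.comp (by fun_prop)
      · exact (continuous_helmP α).comp (by fun_prop)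
    have := h1.tendsto 0
    simp only [F, zero_smul, zero_mul] at this
    exact this.mono_left nhdsWithin_le_nhds

/-! ### The Helmholtz kernel as a distribution -/

/-- The limit η → 0 of the regularized identity. The gradient of Θ_α acquires no singular part at
the origin because xₖ·`helmQ` is only of size |x|⁻². -/
theorem integral_fderiv_mul_helm (α : ℂ) {φ : E3 → ℂ} (hφ : IsTest φ) (k : Fin 3) :
    ∫ x, fderiv ℝ φ x (dirE3 k) * helm α ‖x‖ = -∫ x, φ x * (x k * helmQ α ‖x‖) := by
  refine tendsto_nhds_unique (tendsto_integral_helm_reg α (hφ.fderiv_apply (dirE3 k))) ?_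
  refine ((tendsto_integral_helmQ_reg α hφ k).neg).congr' ?_
  filter_upwards [self_mem_nhdsWithin] with η hη
  rw [integral_fderiv_mul_helm_reg α (ne_of_gt hη) hφ k]

/-- Both sides are, up to sign, the pairing of Θ_α with the same mixed second derivative of φ. In
other words, the gradient of Θ_α has no curl, which removes the vector part of D²Θ_α. -/
theorem integral_fderiv_mul_helmQ_comm (α : ℂ) {φ : E3 → ℂ} (hφ : IsTest φ) (j k : Fin 3) :
    ∫ x, fderiv ℝ φ x (dirE3 j) * (x k * helmQ α ‖x‖)
      = ∫ x, fderiv ℝ φ x (dirE3 k) * (x j * helmQ α ‖x‖) := by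
  have h1 := integral_fderiv_mul_helm α (hφ.fderiv_apply (dirE3 j)) k
  have h2 := integral_fderiv_mul_helm α (hφ.fderiv_apply (dirE3 k)) j
  rw [← neg_inj, ← h1, ← h2]
  congr 1
  ext x
  rw [hφ.fderiv_comm]

theorem sum_integral_fderiv_mul_helmQ (α : ℂ) {φ : E3 → ℂ} (hφ : IsTest φ) :
    ∑ k, ∫ x, fderiv ℝ φ x (dirE3 k) * (x k * helmQ α ‖x‖)
      = α ^ 2 * (∫ x, φ x * helm α ‖x‖) - φ 0 := by
  refine tendsto_nhds_unique (tendsto_finsetSum _ fun k _ =>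
    tendsto_integral_helmQ_reg α (hφ.fderiv_apply (dirE3 k)) k) ?_
  have := ((tendsto_integral_helm_reg α hφ).const_mul (α ^ 2)).add (tendsto_integral_delta_reg α hφ)
  rw [← sub_eq_add_neg] at this
  refine this.congr' ?_
  filter_upwards [self_mem_nhdsWithin] with η hη
  rw [sum_integral_fderiv_mul_helmQ_reg α (ne_of_gt hη) hφ]

/-! ### Coordinates of biquaternions -/

theorem BQ.ext_coords {p q : BQ} (h : ∀ m, coords p m = coords q m) : p = q := by
  ext
  exacts [h 0, h 1, h 2, h 3]

@[simp] theorem coords_ofCoords (c : Fin 4 → ℂ) : coords (ofCoords c) = c := by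
  ext m; fin_cases m <;> rfl

@[simp] theorem coords_add (p q : BQ) (m : Fin 4) :
    coords (p + q) m = coords p m + coords q m := by
  fin_cases m <;> simp [coords]

@[simp] theorem coords_sub (p q : BQ) (m : Fin 4) :
    coords (p - q) m = coords p m - coords q m := by
  fin_cases m <;> simp [coords]

@[simp] theorem coords_neg (p : BQ) (m : Fin 4) : coords (-p) m = -coords p m := by
  fin_cases m <;> simp [coords]

@[simp] theorem coords_zero (m : Fin 4) : coords 0 m = 0 := by
  fin_cases m <;> simp [coords]

@[simp] theorem coords_smul (c : ℂ) (p : BQ) (m : Fin 4) : coords (c • p) m = c * coords p m := by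
  fin_cases m <;> simp [coords]

@[simp] theorem unit_re (k : Fin 3) : (unit k).re = 0 := rfl

@[simp] theorem unit_imI (k : Fin 3) : (unit k).imI = if k = 0 then 1 else 0 := rfl

@[simp] theorem unit_imJ (k : Fin 3) : (unit k).imJ = if k = 1 then 1 else 0 := rfl

@[simp] theorem unit_imK (k : Fin 3) : (unit k).imK = if k = 2 then 1 else 0 := rfl

theorem vec_re (x : E3) : (vec x).re = 0 := by
  simp [vec, Fin.sum_univ_three]

theorem vec_imI (x : E3) : (vec x).imI = x 0 := by
  simp [vec, Fin.sum_univ_three]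

theorem vec_imJ (x : E3) : (vec x).imJ = x 1 := by
  simp [vec, Fin.sum_univ_three]

theorem vec_imK (x : E3) : (vec x).imK = x 2 := by
  simp [vec, Fin.sum_univ_three]

/-- This is K_α = (α − D)Θ_α in coordinates: the vector part of K_α is minus the gradient of Θ_α. -/
theorem Kfun_vector_part (α : ℂ) (x : E3) (k : Fin 3) :
    Theta α x * (1 / (‖x‖ : ℂ) ^ 2 * x k - Complex.I * α / (‖x‖ : ℂ) * x k)
      = -(x k * helmQ α ‖x‖) := by
  rw [helmQ, Theta_eq_helm]; ring

theorem Kfun_re (α : ℂ) (x : E3) : (Kfun α x).re = α * helm α ‖x‖ := by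
  rw [← Theta_eq_helm]
  simp [Kfun, vec_re, mul_comm]

theorem Kfun_imI (α : ℂ) (x : E3) : (Kfun α x).imI = -(x 0 * helmQ α ‖x‖) := by
  rw [← Kfun_vector_part]
  simp [Kfun, vec_imI]

theorem Kfun_imJ (α : ℂ) (x : E3) : (Kfun α x).imJ = -(x 1 * helmQ α ‖x‖) := by
  rw [← Kfun_vector_part]
  simp [Kfun, vec_imJ]

theorem Kfun_imK (α : ℂ) (x : E3) : (Kfun α x).imK = -(x 2 * helmQ α ‖x‖) := by
  rw [← Kfun_vector_part]
  simp [Kfun, vec_imK]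

theorem coords_Kfun (α : ℂ) (x : E3) : coords (Kfun α x) =
    ![α * helm α ‖x‖, -(x 0 * helmQ α ‖x‖), -(x 1 * helmQ α ‖x‖), -(x 2 * helmQ α ‖x‖)] := by
  rw [coords, Kfun_re, Kfun_imI, Kfun_imJ, Kfun_imK]

theorem measurable_helm : Measurable fun p : ℂ × ℝ => helm p.1 p.2 := by
  unfold helm; fun_prop

theorem measurable_helmQ : Measurable fun p : ℂ × ℝ => helmQ p.1 p.2 := by
  have h : Measurable fun p : ℂ × ℝ => Complex.I * p.1 / (p.2 : ℂ) - 1 / (p.2 : ℂ) ^ 2 := by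
    fun_prop
  exact h.mul measurable_helm

theorem measurable_coords_Kfun (m : Fin 4) :
    Measurable fun p : ℂ × E3 => coords (Kfun p.1 p.2) m := by
  have h0 : Measurable fun p : ℂ × E3 => (p.1, ‖p.2‖) := by fun_prop
  have h1 := measurable_helm.comp h0
  have h2 := measurable_helmQ.comp h0
  simp only [Function.comp_def] at h1 h2
  have h3 : ∀ k, Measurable fun p : ℂ × E3 => ((p.2 k : ℝ) : ℂ) := fun k =>
    (continuous_coord k).measurable.comp measurable_snd
  fin_cases m
  · change Measurable fun p : ℂ × E3 => (Kfun p.1 p.2).re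
    simp only [Kfun_re]
    exact measurable_fst.mul h1
  · change Measurable fun p : ℂ × E3 => (Kfun p.1 p.2).imI
    simp only [Kfun_imI]
    exact ((h3 0).mul h2).neg
  · change Measurable fun p : ℂ × E3 => (Kfun p.1 p.2).imJ
    simp only [Kfun_imJ]
    exact ((h3 1).mul h2).neg
  · change Measurable fun p : ℂ × E3 => (Kfun p.1 p.2).imK
    simp only [Kfun_imK]
    exact ((h3 2).mul h2).neg

theorem norm_coords_Kfun_le (α : ℂ) {R : ℝ} {x : E3} (hx : ‖x‖ ≤ R) (m : Fin 4) :
    ‖coords (Kfun α x) m‖ ≤ (‖α‖ + 1) * helmBound α R * (‖x‖ ^ 2)⁻¹ := by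
  rcases eq_or_ne x 0 with rfl | hx0
  -- At the origin both sides are zero, by the convention for division by zero.
  · fin_cases m <;> simp [coords_Kfun, helm]
  have hB := helmBound_nonneg α ((norm_nonneg x).trans hx)
  have h1 := norm_helm_le' α (norm_pos_iff.2 hx0) le_rfl hx
  have h2 := fun k => norm_coord_mul_helmQ_le α hx0 le_rfl hx k
  have hα := norm_nonneg α
  have h3 : ∀ k, ‖-((x k : ℂ) * helmQ α ‖x‖)‖ ≤ (‖α‖ + 1) * helmBound α R * (‖x‖ ^ 2)⁻¹ := by
    intro k
    rw [norm_neg]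
    refine (h2 k).trans ?_
    gcongr
    nlinarith
  rw [coords_Kfun]
  fin_cases m
  · refine (norm_mul_le _ _).trans ((mul_le_mul_of_nonneg_left h1 hα).trans ?_)
    rw [← mul_assoc]
    gcongr
    linarith
  · exact h3 0
  · exact h3 1
  · exact h3 2

theorem integrableOn_of_le_inv_norm_sq {h : E3 → ℂ} (hm : Measurable h) {R C : ℝ}
    (hb : ∀ x, ‖x‖ ≤ R → ‖h x‖ ≤ C * (‖x‖ ^ 2)⁻¹) : IntegrableOn h (Metric.closedBall 0 R) := by
  refine ((integrableOn_inv_norm_sq R).const_mul C).mono' hm.aestronglyMeasurable ?_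
  filter_upwards [ae_restrict_mem measurableSet_closedBall] with x hx
  exact hb x (by simpa using hx)

theorem locallyIntegrable_of_closedBall {X : Type*} [NormedAddCommGroup X] [ProperSpace X]
    [MeasurableSpace X] [BorelSpace X] {ν : Measure X} {h : X → ℂ}
    (hb : ∀ R, IntegrableOn h (Metric.closedBall 0 R) ν) : LocallyIntegrable h ν := by
  rw [locallyIntegrable_iff]
  intro k hk
  obtain ⟨R, hR⟩ := hk.isBounded.subset_closedBall 0
  exact (hb R).mono_set hR

theorem locallyIntegrable_Kfun (α : ℂ) : BQLocallyIntegrable volume (Kfun α) := fun m =>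
  locallyIntegrable_of_closedBall fun _ => integrableOn_of_le_inv_norm_sq
    ((measurable_coords_Kfun m).comp (measurable_const.prodMk measurable_id))
    fun _ hx => norm_coords_Kfun_le α hx m

/-! ### Regular distributions -/

section Regular

theorem coords_regular {X : Type*} [MeasureSpace X] (g : X → BQ) (φ : X → ℂ) (m : Fin 4) :
    coords (regular g φ) m = ∫ p, φ p * coords (g p) m := by
  simp [regular, bqIntegral]

theorem regular_smul {X : Type*} [MeasureSpace X] (c : ℂ) (g : X → BQ) (φ : X → ℂ) :
    regular (fun p => c • g p) φ = c • regular g φ := by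
  refine BQ.ext_coords fun m => ?_
  simp only [coords_regular, coords_smul, ← integral_const_mul]
  congr 1; ext p; ring

variable {X : Type*} [NormedAddCommGroup X] [NormedSpace ℝ X] [MeasureSpace X]

theorem distD_regular (e : Fin 3 → X) (g : X → BQ) (φ : X → ℂ) :
    distD e (regular g) φ = -∑ k, unit k * regular g (fun p => fderiv ℝ φ p (e k)) := by
  simp only [distD, distDeriv]
  have h : ∀ p q : BQ, p * -q = -(p * q) := fun p q => mul_neg p q
  simp only [h, Fin.sum_univ_three]
  refine BQ.ext_coords fun m => ?_
  simp only [coords_add, coords_neg]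
  ring

theorem distD_smul (e : Fin 3 → X) (c : ℂ) (g : X → BQ) (φ : X → ℂ) :
    distD e (regular fun p => c • g p) φ = c • distD e (regular g) φ := by
  rw [distD_regular, distD_regular]
  simp only [regular_smul]
  have h : ∀ p q : BQ, p * c • q = c • (p * q) := fun p q => Algebra.mul_smul_comm _ _ _
  simp only [h, Fin.sum_univ_three]
  refine BQ.ext_coords fun m => ?_
  simp only [coords_add, coords_neg, coords_smul]
  ring

end Regular

theorem regular_re {X : Type*} [MeasureSpace X]
    (g : X → BQ) (φ : X → ℂ) : (regular g φ).re = ∫ p, φ p * (g p).re := coords_regular g φ 0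

theorem regular_imI {X : Type*} [MeasureSpace X]
    (g : X → BQ) (φ : X → ℂ) : (regular g φ).imI = ∫ p, φ p * (g p).imI := coords_regular g φ 1

theorem regular_imJ {X : Type*} [MeasureSpace X]
    (g : X → BQ) (φ : X → ℂ) : (regular g φ).imJ = ∫ p, φ p * (g p).imJ := coords_regular g φ 2

theorem regular_imK {X : Type*} [MeasureSpace X]
    (g : X → BQ) (φ : X → ℂ) : (regular g φ).imK = ∫ p, φ p * (g p).imK := coords_regular g φ 3

theorem integral_mul_const_helm (α : ℂ) (ψ : E3 → ℂ) :
    ∫ x, ψ x * (α * helm α ‖x‖) = α * ∫ x, ψ x * helm α ‖x‖ := by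
  rw [← integral_const_mul]; congr 1; ext x; ring

/-- `D K_α = δ - α K_α` in the sense of distributions. -/
theorem sum_unit_mul_regular_Kfun (α : ℂ) {φ : E3 → ℂ} (hφ : IsTest φ) :
    ∑ k, unit k * regular (Kfun α) (fun x => fderiv ℝ φ x (dirE3 k))
      = α • regular (Kfun α) φ - φ 0 • (1 : BQ) := by
  have h1 := fun k => integral_fderiv_mul_helm α hφ k
  have h2 := sum_integral_fderiv_mul_helmQ α hφ
  have h3 := integral_fderiv_mul_helmQ_comm α hφ
  simp only [Fin.sum_univ_three] at h2 ⊢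
  ext
  · simp [regular_re, regular_imI, regular_imJ, regular_imK, Kfun_re, Kfun_imI, Kfun_imJ, Kfun_imK,
      integral_mul_const_helm, integral_neg]
    linear_combination h2
  · simp [regular_re, regular_imI, regular_imJ, regular_imK, Kfun_re, Kfun_imI, Kfun_imJ, Kfun_imK,
      integral_mul_const_helm, integral_neg]
    -- In a vector component, the derivative of the scalar part αΘ_α matches the corresponding
    -- component of αK_α, and what is left is a component of the curl of the gradient.
    linear_combination α * h1 0 + h3 2 1
  · simp [regular_re, regular_imI, regular_imJ, regular_imK, Kfun_re, Kfun_imI, Kfun_imJ, Kfun_imK,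
      integral_mul_const_helm, integral_neg]
    linear_combination α * h1 1 + h3 0 2
  · simp [regular_re, regular_imI, regular_imJ, regular_imK, Kfun_re, Kfun_imI, Kfun_imJ, Kfun_imK,
      integral_mul_const_helm, integral_neg]
    linear_combination α * h1 2 + h3 1 0

theorem distD_Kfun (α : ℂ) {φ : E3 → ℂ} (hφ : IsTest φ) :
    distD dirE3 (regular (Kfun α)) φ = φ 0 • (1 : BQ) - α • regular (Kfun α) φ := by
  rw [distD_regular, sum_unit_mul_regular_Kfun α hφ, neg_sub]

/-! ### The Fourier-transformed operator -/

theorem isFundamentalSolution_FourierGreen (β ε μ : ℝ) (hβ : β ≠ 0) (hεμ : 0 < ε * μ) {z : ℂ}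
    (hz : z ≠ ((1 / (β * √(ε * μ)) : ℝ) : ℂ)) :
    IsFundamentalSolution (chiralMHat β ε μ z) (FourierGreen β ε μ z) := by
  have ha : 0 < √(ε * μ) := Real.sqrt_pos.2 hεμ
  have hb : ((β * √(ε * μ) : ℝ) : ℂ) ≠ 0 := by exact_mod_cast mul_ne_zero hβ ha.ne'
  have hw : ((β * √(ε * μ) : ℝ) : ℂ) * z - 1 ≠ 0 := by
    intro h
    apply hz
    rw [Complex.ofReal_div, Complex.ofReal_one, eq_div_iff hb]
    linear_combination h
  refine ⟨fun m => ?_, fun φ hφ => ?_⟩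
  · simp only [FourierGreen, coords_smul]
    exact (locallyIntegrable_Kfun _ m).smul (1 / ((((β * √(ε * μ) : ℝ) : ℂ) * z - 1) * Complex.I))
  · have hreg : regular (FourierGreen β ε μ z) =
        fun φ => (1 / ((((β * √(ε * μ) : ℝ) : ℂ) * z - 1) * Complex.I)) •
          regular (Kfun (alphaOf β ε μ z)) φ := by
      ext1 φ; exact regular_smul _ _ _
    have hD : distD dirE3 (regular (FourierGreen β ε μ z)) φ =
        (1 / ((((β * √(ε * μ) : ℝ) : ℂ) * z - 1) * Complex.I)) •
          distD dirE3 (regular (Kfun (alphaOf β ε μ z))) φ := distD_smul _ _ _ _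
    -- The operator equals i(bz − 1)(D + α(z)), and the scalar factor is the inverse of the one in
    -- F.
    rw [chiralMHat, hD, distD_Kfun _ hφ, hreg]
    have hα : alphaOf β ε μ z = ((√(ε * μ) : ℝ) : ℂ) * z / (((β * √(ε * μ) : ℝ) : ℂ) * z - 1) := rfl
    generalize ((β * √(ε * μ) : ℝ) : ℂ) = b at *
    generalize ((√(ε * μ) : ℝ) : ℂ) = a at *
    refine BQ.ext_coords fun m => ?_
    simp only [coords_add, coords_sub, coords_smul]
    rw [hα]
    field_simp
    ring

/-! ### Bessel series -/

/-- The entire function `∑ sᵐ / (m! (m+n)!)`. -/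
def besselE (n : ℕ) (s : ℂ) : ℂ := ∑' m : ℕ, s ^ m / ((m.factorial : ℂ) * ((m + n).factorial : ℂ))

theorem summable_besselE (n : ℕ) (s : ℂ) :
    Summable fun m : ℕ => s ^ m / ((m.factorial : ℂ) * ((m + n).factorial : ℂ)) := by
  refine Summable.of_norm_bounded (Real.summable_pow_div_factorial ‖s‖) fun m => ?_
  rw [norm_div, norm_pow, norm_mul]
  simp only [Complex.norm_natCast]
  have h1 : (1 : ℝ) ≤ (m + n).factorial := by exact_mod_cast Nat.succ_le_of_lt (Nat.factorial_pos _)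
  have h0 : (0 : ℝ) < m.factorial := by exact_mod_cast Nat.factorial_pos _
  gcongr
  nlinarith

theorem hasSum_besselE (n : ℕ) (s : ℂ) :
    HasSum (fun m : ℕ => s ^ m / ((m.factorial : ℂ) * ((m + n).factorial : ℂ))) (besselE n s) :=
  (summable_besselE n s).hasSum

/-- Factoring out (r/2)ⁿ leaves an entire function of (r/2)², so the square roots in the Bessel
argument disappear from the even part. -/
theorem besselJ_eq (n : ℕ) (r : ℝ) :
    (besselJ n r : ℂ) = ((r / 2 : ℝ) : ℂ) ^ n * besselE n ((-(r / 2) ^ 2 : ℝ) : ℂ) := by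
  rw [besselJ, besselE, Complex.ofReal_tsum, ← tsum_mul_left]
  congr 1
  ext m
  push_cast
  rw [pow_add, pow_mul, neg_pow (((r : ℂ) / 2) ^ 2)]
  ring

/-! ### Fourier transforms of causal exponentials -/

theorem integrableOn_pow_mul_cexp (n : ℕ) {l : ℂ} (hl : 0 < l.re) :
    IntegrableOn (fun s : ℝ => (s : ℂ) ^ n / n.factorial * Complex.exp (-l * s)) (Set.Ioi 0) := by
  have h := (integrableOn_rpow_mul_exp_neg_mul_rpow (p := 1) (s := n) (b := l.re)
    (by linarith [(Nat.cast_nonneg n : (0 : ℝ) ≤ n)]) one_pos hl).const_mul ((n.factorial : ℝ)⁻¹)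
  refine Integrable.mono' h (by fun_prop) ?_
  filter_upwards [ae_restrict_mem measurableSet_Ioi] with s hs
  rw [norm_mul, norm_div, norm_pow, Complex.norm_exp, Complex.norm_real, Complex.norm_natCast,
    Real.norm_of_nonneg (le_of_lt hs)]
  simp
  ring_nf
  rfl

theorem tendsto_pow_mul_cexp (n : ℕ) {l : ℂ} (hl : 0 < l.re) :
    Tendsto (fun s : ℝ => (s : ℂ) ^ n / n.factorial * Complex.exp (-l * s)) atTop (𝓝 0) := by
  rw [tendsto_zero_iff_norm_tendsto_zero]
  have h := (tendsto_rpow_mul_exp_neg_mul_atTop_nhds_zero n l.re hl).const_mul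
    ((n.factorial : ℝ)⁻¹)
  rw [mul_zero] at h
  refine h.congr' ?_
  filter_upwards [eventually_ge_atTop 0] with s hs
  rw [norm_mul, norm_div, norm_pow, Complex.norm_exp, Complex.norm_real, Complex.norm_natCast,
    Real.norm_of_nonneg hs]
  simp
  ring_nf

/-- The derivative combines the integrands of orders n + 1 and n; its integral over the half-line is
zero and yields the recursion Iₙ₊₁ = Iₙ/l. -/
theorem hasDerivAt_pow_mul_cexp (n : ℕ) {l : ℂ} (hl : l ≠ 0) (s : ℝ) :
    HasDerivAt (fun s : ℝ => -l⁻¹ * ((s : ℂ) ^ (n + 1) / (n + 1).factorial * Complex.exp (-l * s)))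
      ((s : ℂ) ^ (n + 1) / (n + 1).factorial * Complex.exp (-l * s)
        - l⁻¹ * ((s : ℂ) ^ n / n.factorial * Complex.exp (-l * s))) s := by
  have h1 : HasDerivAt (fun s : ℝ => (s : ℂ)) 1 s := Complex.ofRealCLM.hasDerivAt
  have h2 := (((h1.pow (n + 1)).div_const ((n + 1).factorial : ℂ)).mul
    (h1.const_mul (-l)).cexp).const_mul (-l⁻¹)
  refine h2.congr_deriv ?_
  have hf : (n.factorial : ℂ) ≠ 0 := by exact_mod_cast Nat.factorial_ne_zero n
  have hn : (n : ℂ) + 1 ≠ 0 := by exact_mod_cast Nat.succ_ne_zero n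
  rw [Nat.factorial_succ]
  simp only [Pi.pow_apply, add_tsub_cancel_right]
  push_cast
  field_simp
  ring

theorem integral_pow_mul_cexp (n : ℕ) {l : ℂ} (hl : 0 < l.re) :
    ∫ s : ℝ in Set.Ioi 0, (s : ℂ) ^ n / n.factorial * Complex.exp (-l * s) = (l ^ (n + 1))⁻¹ := by
  have hl0 : l ≠ 0 := by rintro rfl; simp at hl
  induction n with
  | zero =>
    have := integral_exp_mul_complex_Ioi (a := -l) (by simpa using hl) 0
    simpa using this
  | succ n ih =>
    have h1 := integrableOn_pow_mul_cexp n hl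
    have h2 := integrableOn_pow_mul_cexp (n + 1) hl
    have h3 := integral_Ioi_of_hasDerivAt_of_tendsto' (a := 0)
      (fun s _ => hasDerivAt_pow_mul_cexp n hl0 s) (h2.sub (h1.const_mul _))
      (by simpa using (tendsto_pow_mul_cexp (n + 1) hl).const_mul (-l⁻¹))
    rw [integral_sub h2 (h1.const_mul _), integral_const_mul, ih] at h3
    simp only [Complex.ofReal_zero, ne_eq, Nat.add_eq_zero_iff, one_ne_zero, and_false,
      not_false_eq_true, zero_pow, zero_div, zero_mul, mul_zero, sub_zero] at h3
    rw [sub_eq_zero.1 h3, pow_succ _ (n + 1)]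
    field_simp

theorem sub_ne_zero_of_im_pos {p : ℂ} (hp : 0 < p.im) (w : ℝ) : (w : ℂ) - p ≠ 0 := by
  intro h
  have := congrArg Complex.im h
  simp at this
  exact hp.ne' this

theorem im_le_norm_sub {p : ℂ} (hp : 0 < p.im) (w : ℝ) : p.im ≤ ‖(w : ℂ) - p‖ := by
  have := Complex.abs_im_le_norm ((w : ℂ) - p)
  simpa [abs_of_pos hp] using this

theorem integrable_inv_sub_sq {p : ℂ} (hp : 0 < p.im) :
    Integrable fun w : ℝ => ‖((w : ℂ) - p) ^ 2‖⁻¹ := by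
  have h := ((integrable_inv_one_add_sq.comp_div hp.ne').comp_sub_right p.re).const_mul
    ((p.im ^ 2)⁻¹)
  refine h.congr (Eventually.of_forall fun w => ?_)
  have h1 : ‖((w : ℂ) - p) ^ 2‖ = (w - p.re) ^ 2 + p.im ^ 2 := by
    rw [norm_pow, Complex.sq_norm, Complex.normSq_apply]
    simp
    ring
  simp only [h1]
  field_simp
  ring

theorem continuous_inv_sub_pow {p : ℂ} (hp : 0 < p.im) (n : ℕ) :
    Continuous fun w : ℝ => (((w : ℂ) - p) ^ n)⁻¹ :=
  Continuous.inv₀ (by fun_prop) fun w => pow_ne_zero n (sub_ne_zero_of_im_pos hp w)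

theorem norm_inv_sub_pow_le {p : ℂ} (hp : 0 < p.im) (n : ℕ) (w : ℝ) :
    ‖(((w : ℂ) - p) ^ (n + 2))⁻¹‖ ≤ (p.im⁻¹) ^ n * ‖((w : ℂ) - p) ^ 2‖⁻¹ := by
  rw [norm_inv, pow_add, norm_mul, mul_inv, norm_pow _ n, inv_pow]
  gcongr
  exact im_le_norm_sub hp w

theorem integrable_inv_sub_pow {p : ℂ} (hp : 0 < p.im) (n : ℕ) :
    Integrable fun w : ℝ => (((w : ℂ) - p) ^ (n + 2))⁻¹ :=
  ((integrable_inv_sub_sq hp).const_mul _).mono' (continuous_inv_sub_pow hp _).aestronglyMeasurable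
    (Eventually.of_forall (norm_inv_sub_pow_le hp n))

theorem norm_cexp_I_mul (w t : ℝ) : ‖Complex.exp (Complex.I * w * t)‖ = 1 := by
  rw [Complex.norm_exp]; simp

/-- The function `sⁿ⁺¹ / (n+1)! · exp(ips)` for `s ≥ 0`, extended by zero. -/
def causalPow (n : ℕ) (p : ℂ) (s : ℝ) : ℂ :=
  ((max s 0 : ℝ) : ℂ) ^ (n + 1) / (n + 1).factorial
    * Complex.exp (Complex.I * p * ((max s 0 : ℝ) : ℂ))

/-- The exponent n + 1, and not n, makes the function vanish at 0, so the cut-off causes no jump.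
Pointwise Fourier inversion relies on this. -/
theorem continuous_causalPow (n : ℕ) (p : ℂ) : Continuous (causalPow n p) := by
  unfold causalPow
  have : Continuous fun s : ℝ => ((max s 0 : ℝ) : ℂ) := by fun_prop
  fun_prop

theorem causalPow_of_nonpos (n : ℕ) (p : ℂ) {s : ℝ} (hs : s ≤ 0) : causalPow n p s = 0 := by
  simp [causalPow, max_eq_right hs]

theorem causalPow_of_nonneg (n : ℕ) (p : ℂ) {s : ℝ} (hs : 0 ≤ s) :
    causalPow n p s = (s : ℂ) ^ (n + 1) / (n + 1).factorial
      * Complex.exp (Complex.I * p * (s : ℂ)) := by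
  simp [causalPow, max_eq_left hs]

theorem integrable_causalPow (n : ℕ) {p : ℂ} (hp : 0 < p.im) : Integrable (causalPow n p) := by
  have h := integrableOn_pow_mul_cexp (n + 1) (l := -(Complex.I * p)) (by simpa using hp)
  rw [← integrableOn_iff_integrable_of_support_subset (s := Set.Ioi 0)]
  · refine h.congr_fun (fun s hs => ?_) measurableSet_Ioi
    simp only [neg_neg]
    rw [causalPow_of_nonneg n p (le_of_lt hs)]
  · intro s hs
    by_contra h
    exact hs (causalPow_of_nonpos n p (not_lt.1 h))

theorem fourier_causalPow (n : ℕ) {p : ℂ} (hp : 0 < p.im) (ξ : ℝ) :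
    FourierTransform.fourier (causalPow n p) ξ
      = (Complex.I ^ (n + 2))⁻¹ * ((((2 * Real.pi * ξ : ℝ) : ℂ) - p) ^ (n + 2))⁻¹ := by
  have h := integral_pow_mul_cexp (n + 1)
    (l := Complex.I * (((2 * Real.pi * ξ : ℝ) : ℂ) - p)) (by simpa using hp)
  rw [mul_pow, mul_inv] at h
  rw [← h, Real.fourier_real_eq_integral_exp_smul,
    ← setIntegral_eq_integral_of_forall_compl_eq_zero (s := Set.Ioi 0)]
  · refine setIntegral_congr_fun measurableSet_Ioi fun s hs => ?_
    rw [causalPow_of_nonneg n p (le_of_lt hs), smul_eq_mul, mul_left_comm, ← Complex.exp_add]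
    congr 2
    push_cast
    ring
  · intro s hs
    rw [causalPow_of_nonpos n p (not_lt.1 hs), smul_zero]

/-- Fourier inversion for `causalPow`, with w = 2πξ, takes the place of a residue computation. The
order n + 2 ≥ 2 makes the transform integrable. -/
theorem integral_cexp_mul_inv_sub_pow (n : ℕ) {p : ℂ} (hp : 0 < p.im) (t : ℝ) :
    ∫ w : ℝ, Complex.exp (Complex.I * w * t) * (((w : ℂ) - p) ^ (n + 2))⁻¹
      = 2 * Real.pi * Complex.I ^ (n + 2) * causalPow n p t := by
  have hF : FourierTransform.fourier (causalPow n p) = fun ξ : ℝ =>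
      (Complex.I ^ (n + 2))⁻¹ * ((((2 * Real.pi * ξ : ℝ) : ℂ) - p) ^ (n + 2))⁻¹ :=
    funext (fourier_causalPow n hp)
  have h2π : (2 * Real.pi : ℝ) ≠ 0 := by positivity
  have hint : Integrable (FourierTransform.fourier (causalPow n p)) := by
    rw [hF]
    exact ((integrable_inv_sub_pow hp n).comp_mul_left' h2π).const_mul _
  have hinv := congrFun ((continuous_causalPow n p).fourierInv_fourier_eq
    (integrable_causalPow n hp) hint) t
  rw [← hinv, Real.fourierInv_eq', hF]
  have hs := Measure.integral_comp_mul_left (fun w : ℝ =>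
    Complex.exp (Complex.I * w * t) * (((w : ℂ) - p) ^ (n + 2))⁻¹) (2 * Real.pi)
  have hI : (Complex.I ^ (n + 2)) ≠ 0 := pow_ne_zero _ Complex.I_ne_zero
  have h2 : ∀ ξ : ℝ, Complex.exp (((2 * Real.pi * inner ℝ ξ t : ℝ) : ℂ) * Complex.I) •
      ((Complex.I ^ (n + 2))⁻¹ * ((((2 * Real.pi * ξ : ℝ) : ℂ) - p) ^ (n + 2))⁻¹) =
      (Complex.I ^ (n + 2))⁻¹ * (Complex.exp (Complex.I * (2 * Real.pi * ξ : ℝ) * t)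
        * ((((2 * Real.pi * ξ : ℝ) : ℂ) - p) ^ (n + 2))⁻¹) := by
    intro ξ
    rw [smul_eq_mul, mul_left_comm]
    congr 3
    simp
    ring
  simp only [h2]
  rw [integral_const_mul, hs, abs_of_pos (by positivity), Complex.real_smul]
  have hπ : (Real.pi : ℂ) ≠ 0 := by exact_mod_cast Real.pi_ne_zero
  generalize ∫ w : ℝ, Complex.exp (Complex.I * w * t) * (((w : ℂ) - p) ^ (n + 2))⁻¹ = J
  push_cast
  field_simp

theorem tendsto_setIntegral_Ioc {g : ℝ → ℂ} (hg : Integrable g) :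
    Tendsto (fun R : ℝ × ℝ => ∫ w in Set.Ioc (-R.1) R.2, g w) (atTop ×ˢ atTop) (𝓝 (∫ w, g w)) :=
  (aecover_Ioc (tendsto_neg_atTop_atBot.comp tendsto_fst)
    tendsto_snd).integral_tendsto_of_countably_generated hg

theorem tendsto_inv_sub_zero {p : ℂ} (t : ℝ) {l : Filter ℝ}
    (hl : Tendsto (fun w : ℝ => |w|) l atTop) :
    Tendsto (fun w : ℝ => Complex.exp (Complex.I * w * t) * ((w : ℂ) - p)⁻¹) l (𝓝 0) := by
  rw [tendsto_zero_iff_norm_tendsto_zero]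
  simp only [norm_mul, norm_cexp_I_mul, one_mul, norm_inv]
  refine tendsto_inv_atTop_zero.comp (tendsto_atTop_mono (fun w => ?_)
    (tendsto_atTop_add_const_right l (-‖p‖) hl))
  have := norm_sub_norm_le (w : ℂ) p
  simpa [sub_eq_add_neg] using this

/-- A simple pole gives only conditional convergence. Integrating e^{iwt} once raises the pole to
order 2 at the cost of a factor (it)⁻¹, hence t ≠ 0, and the boundary terms vanish at each end
separately. -/
theorem tendsto_integral_cexp_mul_inv_sub {p : ℂ} (hp : 0 < p.im) {t : ℝ} (ht : t ≠ 0) :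
    Tendsto (fun R : ℝ × ℝ => ∫ w in Set.Ioc (-R.1) R.2,
        Complex.exp (Complex.I * w * t) * ((w : ℂ) - p)⁻¹) (atTop ×ˢ atTop)
      (𝓝 (2 * Real.pi * Complex.I * (heaviside t * Complex.exp (Complex.I * p * t)))) := by
  have htc : (t : ℂ) ≠ 0 := by exact_mod_cast ht
  let E : ℝ → ℂ := fun w => Complex.exp (Complex.I * w * t)
  have hparts : ∀ a b : ℝ, a ≤ b → ∫ w in Set.Ioc a b, E w * ((w : ℂ) - p)⁻¹
      = (Complex.I * t)⁻¹ * (E b * ((b : ℂ) - p)⁻¹ - E a * ((a : ℂ) - p)⁻¹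
        + ∫ w in Set.Ioc a b, E w * (((w : ℂ) - p) ^ (0 + 2))⁻¹) := by
    intro a b hab
    have hof : ∀ w : ℝ, HasDerivAt (fun w : ℝ => (w : ℂ)) 1 w := fun w =>
      Complex.ofRealCLM.hasDerivAt
    have hu : ∀ w : ℝ, HasDerivAt (fun w : ℝ => ((w : ℂ) - p)⁻¹)
        (-(((w : ℂ) - p) ^ (0 + 2))⁻¹) w := fun w =>
      (((hof w).sub_const p).inv (sub_ne_zero_of_im_pos hp w)).congr_deriv (by
        rw [zero_add, neg_div, one_div])
    have hE : ∀ w : ℝ, HasDerivAt E (E w * (Complex.I * t)) w := fun w =>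
      (((hof w).const_mul Complex.I).mul_const (t : ℂ)).cexp.congr_deriv (by simp [E])
    have hv : ∀ w : ℝ, HasDerivAt (fun w => (Complex.I * t)⁻¹ * E w) (E w) w := fun w =>
      ((hE w).const_mul _).congr_deriv (by
        have := mul_ne_zero Complex.I_ne_zero htc
        field_simp)
    have hEc : Continuous E := by simp only [E]; fun_prop
    have h := intervalIntegral.integral_mul_deriv_eq_deriv_mul (a := a) (b := b)
      (fun w _ => hu w) (fun w _ => hv w)
      ((continuous_inv_sub_pow hp (0 + 2)).neg.intervalIntegrable _ _)
      (hEc.intervalIntegrable _ _)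
    rw [intervalIntegral.integral_of_le hab, intervalIntegral.integral_of_le hab] at h
    have h1 : ∫ w in Set.Ioc a b, E w * ((w : ℂ) - p)⁻¹
        = ∫ w in Set.Ioc a b, ((w : ℂ) - p)⁻¹ * E w := by simp only [mul_comm]
    have h2 : ∫ w in Set.Ioc a b, -(((w : ℂ) - p) ^ (0 + 2))⁻¹ * ((Complex.I * t)⁻¹ * E w)
        = -((Complex.I * t)⁻¹ * ∫ w in Set.Ioc a b, E w * (((w : ℂ) - p) ^ (0 + 2))⁻¹) := by
      rw [← integral_const_mul, ← integral_neg]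
      congr 1; ext w; ring
    rw [h1, h, h2]
    ring
  have hint : Integrable fun w : ℝ => E w * (((w : ℂ) - p) ^ (0 + 2))⁻¹ := by
    refine (integrable_inv_sub_pow hp 0).bdd_mul (c := 1) ?_ ?_
    · exact Continuous.aestronglyMeasurable (by simp only [E]; fun_prop)
    · exact Eventually.of_forall fun w => (norm_cexp_I_mul w t).le
  have hlim := tendsto_setIntegral_Ioc hint
  have hA : Tendsto (fun R : ℝ × ℝ => E R.2 * ((R.2 : ℂ) - p)⁻¹) (atTop ×ˢ atTop) (𝓝 0) :=
    (tendsto_inv_sub_zero t tendsto_abs_atTop_atTop).comp tendsto_snd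
  have hB : Tendsto (fun R : ℝ × ℝ => E (-R.1) * (((-R.1 : ℝ) : ℂ) - p)⁻¹)
      (atTop ×ˢ atTop) (𝓝 0) :=
    (tendsto_inv_sub_zero t tendsto_abs_atBot_atTop).comp
      (tendsto_neg_atTop_atBot.comp tendsto_fst)
  have hall := ((hA.sub hB).add hlim).const_mul ((Complex.I * t)⁻¹)
  have hval : (Complex.I * t)⁻¹ * (0 - 0 + ∫ w : ℝ, E w * (((w : ℂ) - p) ^ (0 + 2))⁻¹)
      = 2 * Real.pi * Complex.I * (heaviside t * Complex.exp (Complex.I * p * t)) := by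
    simp only [E]
    rw [integral_cexp_mul_inv_sub_pow 0 hp t]
    rcases lt_or_ge t 0 with h | h
    · simp [causalPow_of_nonpos 0 p h.le, heaviside, not_le.2 h]
    · rw [causalPow_of_nonneg 0 p h, heaviside, if_pos h]
      simp
      field_simp
  rw [hval] at hall
  refine hall.congr' ?_
  have hR : ∀ᶠ R : ℝ × ℝ in atTop ×ˢ atTop, 0 ≤ R.1 ∧ 0 ≤ R.2 :=
    (tendsto_fst.eventually (eventually_ge_atTop 0)).and
      (tendsto_snd.eventually (eventually_ge_atTop 0))
  filter_upwards [hR] with R hR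
  rw [hparts _ _ (by linarith [hR.1, hR.2])]

/-! ### Fourier integrals of Laurent series -/

/-- On the real line |w − p| ≥ Im p, so each term is at most ‖a m‖(Im p)⁻ᵐ|w − p|⁻², and sum and
integral may be interchanged. -/
theorem integral_laurent {p : ℂ} (hp : 0 < p.im) (t : ℝ) {a : ℕ → ℂ} {g : ℝ → ℂ}
    (hg : Continuous g) (ha : Summable fun m => ‖a m‖ * p.im⁻¹ ^ m)
    (hs : ∀ w : ℝ, HasSum (fun m => a m * (((w : ℂ) - p) ^ (m + 2))⁻¹) (g w)) :
    Integrable (fun w : ℝ => Complex.exp (Complex.I * w * t) * g w) ∧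
    ∫ w : ℝ, Complex.exp (Complex.I * w * t) * g w
      = ∑' m, a m * (2 * Real.pi * Complex.I ^ (m + 2) * causalPow m p t) := by
  have hE : Continuous fun w : ℝ => Complex.exp (Complex.I * w * t) := by fun_prop
  have hterm : ∀ m (w : ℝ), ‖Complex.exp (Complex.I * w * t) *
      (a m * (((w : ℂ) - p) ^ (m + 2))⁻¹)‖ ≤ ‖a m‖ * p.im⁻¹ ^ m * ‖((w : ℂ) - p) ^ 2‖⁻¹ := by
    intro m w
    rw [norm_mul, norm_cexp_I_mul, one_mul, norm_mul, mul_assoc]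
    exact mul_le_mul_of_nonneg_left (norm_inv_sub_pow_le hp m w) (norm_nonneg _)
  have hbase := integrable_inv_sub_sq hp
  have hint : ∀ m, Integrable fun w : ℝ => Complex.exp (Complex.I * w * t) *
      (a m * (((w : ℂ) - p) ^ (m + 2))⁻¹) := fun m =>
    (hbase.const_mul _).mono'
      (hE.mul (continuous_const.mul (continuous_inv_sub_pow hp _))).aestronglyMeasurable
      (Eventually.of_forall (hterm m))
  have hs' : ∀ w : ℝ, HasSum (fun m => Complex.exp (Complex.I * w * t) *
      (a m * (((w : ℂ) - p) ^ (m + 2))⁻¹)) (Complex.exp (Complex.I * w * t) * g w) := fun w =>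
    (hs w).mul_left _
  constructor
  · refine (hbase.const_mul (∑' m, ‖a m‖ * p.im⁻¹ ^ m)).mono' (hE.mul hg).aestronglyMeasurable
      (Eventually.of_forall fun w => ?_)
    exact (hs' w).norm_le_of_bounded (ha.hasSum.mul_right _) fun m => hterm m w
  · have hsum := hasSum_integral_of_summable_integral_norm hint (by
      refine Summable.of_nonneg_of_le (fun m => integral_nonneg fun _ => norm_nonneg _)
        (fun m => integral_mono (hint m).norm (hbase.const_mul _) (hterm m)) ?_
      simp only [integral_const_mul]
      exact ha.mul_right _)
    simp only [(hs' _).tsum_eq] at hsum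
    rw [← hsum.tsum_eq]
    congr 1
    ext m
    rw [← integral_cexp_mul_inv_sub_pow m hp t, ← integral_const_mul]
    congr 1; ext w; ring

theorem tendsto_integral_cexp_div {p : ℂ} (hp : 0 < p.im) {t : ℝ} (ht : t ≠ 0) (A : ℂ) :
    Tendsto (fun R : ℝ × ℝ => ∫ w in Set.Ioc (-R.1) R.2, Complex.exp (Complex.I * w * t) *
        (Complex.exp (A / ((w : ℂ) - p)) * ((w : ℂ) - p)⁻¹)) (atTop ×ˢ atTop)
      (𝓝 (2 * Real.pi * Complex.I * (heaviside t * Complex.exp (Complex.I * p * t))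
        * besselE 0 (A * (Complex.I * t)))) := by
  have hne := sub_ne_zero_of_im_pos hp
  have hinv : Continuous fun w : ℝ => ((w : ℂ) - p)⁻¹ := by
    simpa using continuous_inv_sub_pow hp 1
  -- Subtracting 1 removes the simple pole, which is treated as an improper integral and supplies
  -- the zeroth term of `besselE 0`; the remainder starts at order 2.
  let g : ℝ → ℂ := fun w => (Complex.exp (A / ((w : ℂ) - p)) - 1) * ((w : ℂ) - p)⁻¹
  have hg : Continuous g := by
    simp only [g, div_eq_mul_inv]
    fun_prop
  have hs : ∀ w : ℝ, HasSum (fun m : ℕ => A ^ (m + 1) / (m + 1).factorial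
      * (((w : ℂ) - p) ^ (m + 2))⁻¹) (g w) := by
    intro w
    have h := NormedSpace.expSeries_div_hasSum_exp (𝔸 := ℂ) (A / ((w : ℂ) - p))
    rw [← Complex.exp_eq_exp_ℂ] at h
    have h1 := ((hasSum_nat_add_iff' 1).2 h).mul_right ((w : ℂ) - p)⁻¹
    simp only [Finset.range_one, Finset.sum_singleton, pow_zero, Nat.factorial_zero, Nat.cast_one,
      div_one] at h1
    have e : ∀ m : ℕ, A ^ (m + 1) / (m + 1).factorial * (((w : ℂ) - p) ^ (m + 2))⁻¹
        = (A / ((w : ℂ) - p)) ^ (m + 1) / (m + 1).factorial * ((w : ℂ) - p)⁻¹ := fun m => by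
      have := hne w
      rw [div_pow]
      field_simp
      ring
    simp only [e]
    exact h1
  have ha : Summable fun m : ℕ => ‖A ^ (m + 1) / ((m + 1).factorial : ℂ)‖ * p.im⁻¹ ^ m := by
    have h := ((summable_nat_add_iff 1).2
      (Real.summable_pow_div_factorial (‖A‖ * p.im⁻¹))).mul_left p.im
    refine h.congr fun m => ?_
    rw [norm_div, norm_pow, Complex.norm_natCast, mul_pow, pow_succ p.im⁻¹]
    have := hp.ne'
    field_simp
  obtain ⟨hint, hval⟩ := integral_laurent hp t hg ha hs
  have hlim := (tendsto_integral_cexp_mul_inv_sub hp ht).add (tendsto_setIntegral_Ioc hint)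
  have hE : Continuous fun w : ℝ => Complex.exp (Complex.I * w * t) := by fun_prop
  have hsum : (2 * Real.pi * Complex.I * (heaviside t * Complex.exp (Complex.I * p * t)))
        + ∫ w : ℝ, Complex.exp (Complex.I * w * t) * g w =
      2 * Real.pi * Complex.I * (heaviside t * Complex.exp (Complex.I * p * t))
        * besselE 0 (A * (Complex.I * t)) := by
    rw [hval]
    rcases lt_or_ge t 0 with h | h
    · simp [causalPow_of_nonpos _ p h.le, heaviside, not_le.2 h]
    · have h1 := ((hasSum_nat_add_iff' 1).2 (hasSum_besselE 0 (A * (Complex.I * t)))).mul_left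
        (2 * Real.pi * Complex.I * (heaviside t * Complex.exp (Complex.I * p * t)))
      rw [tsum_congr, h1.tsum_eq]
      swap
      · intro m
        rw [causalPow_of_nonneg m p h, heaviside, if_pos h, add_zero, mul_pow, mul_pow]
        push_cast
        ring
      simp
      ring
  rw [hsum] at hlim
  refine hlim.congr fun R => ?_
  rw [← integral_add]
  · congr 1; ext w; simp only [g]; ring
  · exact ((hE.mul hinv).integrableOn_Icc (a := -R.1) (b := R.2)).mono_set Set.Ioc_subset_Icc_self
  · exact hint.integrableOn

theorem tendsto_integral_cexp_div_sq {p : ℂ} (hp : 0 < p.im) (t : ℝ) (A : ℂ) :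
    Tendsto (fun R : ℝ × ℝ => ∫ w in Set.Ioc (-R.1) R.2, Complex.exp (Complex.I * w * t) *
        (Complex.exp (A / ((w : ℂ) - p)) * (((w : ℂ) - p) ^ 2)⁻¹)) (atTop ×ˢ atTop)
      (𝓝 (2 * Real.pi * Complex.I * (heaviside t * Complex.exp (Complex.I * p * t))
        * (Complex.I * t * besselE 1 (A * (Complex.I * t))))) := by
  have hne := sub_ne_zero_of_im_pos hp
  have hinv : Continuous fun w : ℝ => ((w : ℂ) - p)⁻¹ := by
    simpa using continuous_inv_sub_pow hp 1
  let g : ℝ → ℂ := fun w => Complex.exp (A / ((w : ℂ) - p)) * (((w : ℂ) - p) ^ 2)⁻¹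
  have hg : Continuous g := by
    have := continuous_inv_sub_pow hp 2
    simp only [g, div_eq_mul_inv]
    fun_prop
  have hs : ∀ w : ℝ, HasSum (fun m : ℕ => A ^ m / m.factorial
      * (((w : ℂ) - p) ^ (m + 2))⁻¹) (g w) := by
    intro w
    have h := NormedSpace.expSeries_div_hasSum_exp (𝔸 := ℂ) (A / ((w : ℂ) - p))
    rw [← Complex.exp_eq_exp_ℂ] at h
    have e : ∀ m : ℕ, A ^ m / m.factorial * (((w : ℂ) - p) ^ (m + 2))⁻¹
        = (A / ((w : ℂ) - p)) ^ m / m.factorial * (((w : ℂ) - p) ^ 2)⁻¹ := fun m => by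
      have := hne w
      rw [div_pow]
      field_simp
      ring
    simp only [e]
    exact h.mul_right (((w : ℂ) - p) ^ 2)⁻¹
  have ha : Summable fun m : ℕ => ‖A ^ m / (m.factorial : ℂ)‖ * p.im⁻¹ ^ m := by
    refine (Real.summable_pow_div_factorial (‖A‖ * p.im⁻¹)).congr fun m => ?_
    rw [norm_div, norm_pow, Complex.norm_natCast, mul_pow]
    ring
  obtain ⟨hint, hval⟩ := integral_laurent hp t hg ha hs
  have hlim := tendsto_setIntegral_Ioc hint
  have hsum : ∫ w : ℝ, Complex.exp (Complex.I * w * t) * g w =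
      2 * Real.pi * Complex.I * (heaviside t * Complex.exp (Complex.I * p * t))
        * (Complex.I * t * besselE 1 (A * (Complex.I * t))) := by
    rw [hval]
    rcases lt_or_ge t 0 with h | h
    · simp [causalPow_of_nonpos _ p h.le, heaviside, not_le.2 h]
    · have h1 := (hasSum_besselE 1 (A * (Complex.I * t))).mul_left
        (2 * Real.pi * Complex.I * (heaviside t * Complex.exp (Complex.I * p * t))
          * (Complex.I * t))
      rw [tsum_congr, h1.tsum_eq]
      swap
      · intro m
        rw [causalPow_of_nonneg m p h, heaviside, if_pos h, mul_pow, mul_pow]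
        push_cast
        ring
      ring
  rwa [hsum] at hlim

/-! ### The Green function in closed form -/

/-- The biquaternion-valued function `Θ_α(x) (1 - i x/|x|)`. -/
def Vfun (α : ℂ) (x : E3) : BQ :=
  Theta α x • ((1 : BQ) - (Complex.I / (‖x‖ : ℂ)) • vec x)

theorem Theta_add (α δ : ℂ) (x : E3) :
    Theta (α + δ) x = Complex.exp (Complex.I * δ * ‖x‖) * Theta α x := by
  rw [Theta, Theta, mul_add, add_mul, Complex.exp_add]
  ring

/-- Apart from the factor e^{iδ|x|}, the kernel is affine in its wave number. With δ a multiple of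
the inverse distance to the singular point, this yields an exponential of A/(w − p) times two
powers. -/
theorem coords_Kfun_add (α δ : ℂ) (x : E3) (m : Fin 4) :
    coords (Kfun (α + δ) x) m = Complex.exp (Complex.I * δ * ‖x‖) *
      (coords (Kfun α x) m + δ * coords (Vfun α x) m) := by
  simp only [Kfun, Vfun, coords_smul, coords_add, coords_sub, Theta_add]
  ring

/-- Partial fractions isolate the pole of the wave number at bz = 1, which is the essential
singularity of F for x ≠ 0. -/
theorem alphaOf_eq {β ε μ : ℝ} (hβ : β ≠ 0) {z : ℂ}
    (hw : ((β * √(ε * μ) : ℝ) : ℂ) * z - 1 ≠ 0) :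
    alphaOf β ε μ z = ((1 / β : ℝ) : ℂ) + 1 / (β * (((β * √(ε * μ) : ℝ) : ℂ) * z - 1)) := by
  have hβ' : (β : ℂ) ≠ 0 := by exact_mod_cast hβ
  rw [alphaOf, Complex.ofReal_div, Complex.ofReal_one,
    div_add_div _ _ hβ' (mul_ne_zero hβ' hw), div_eq_div_iff hw
      (mul_ne_zero hβ' (mul_ne_zero hβ' hw))]
  push_cast
  ring

theorem sq_rpow_quarter {s : ℝ} (hs : 0 ≤ s) : (s ^ (1 / 4 : ℝ)) ^ 2 = √s := by
  rw [Real.sqrt_eq_rpow, ← Real.rpow_natCast, ← Real.rpow_mul hs]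
  norm_num

theorem coords_green (β ε μ : ℝ) (hβ : β ≠ 0) (hεμ : 0 < ε * μ) (t : ℝ) (x : E3) (m : Fin 4) :
    coords (green β ε μ (t, x)) m =
      heaviside t * Complex.exp (Complex.I * t / ((β * √(ε * μ) : ℝ) : ℂ))
        / ((β * √(ε * μ) : ℝ) : ℂ) *
      (besselE 0 (Complex.I * ‖x‖ / β * (Complex.I * t / ((β * √(ε * μ) : ℝ) : ℂ))) *
          coords (Kfun ((1 / β : ℝ) : ℂ) x) m +
        1 / β * (Complex.I * t / ((β * √(ε * μ) : ℝ) : ℂ) *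
          besselE 1 (Complex.I * ‖x‖ / β * (Complex.I * t / ((β * √(ε * μ) : ℝ) : ℂ)))) *
          coords (Vfun ((1 / β : ℝ) : ℂ) x) m) := by
  rcases lt_or_ge t 0 with ht | ht
  · simp [green, heaviside, not_le.2 ht]
  rcases eq_or_ne x 0 with rfl | hx
  · simp [green, Vfun, Kfun, Theta]
  have hr : 0 < ‖x‖ := norm_pos_iff.2 hx
  set r := ‖x‖ with hrdef
  set q := (ε * μ) ^ (1 / 4 : ℝ) with hq
  have hq0 : 0 < q := Real.rpow_pos_of_pos hεμ _
  have hqa : √(ε * μ) = q ^ 2 := (sq_rpow_quarter hεμ.le).symm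
  have harg : besselArg β ε μ t x / 2 = √(t * r) / (β * q) := by
    rw [besselArg]; ring
  have hs : ((-(√(t * r) / (β * q)) ^ 2 : ℝ) : ℂ) =
      Complex.I * r / β * (Complex.I * t / ((β * √(ε * μ) : ℝ) : ℂ)) := by
    rw [div_pow, Real.sq_sqrt (by positivity), hqa]
    have hI : Complex.I * r / β * (Complex.I * t / ((β * q ^ 2 : ℝ) : ℂ)) =
      -(t * r / (β * (β * q ^ 2))) := by
      push_cast
      rw [div_mul_div_comm, mul_mul_mul_comm, Complex.I_mul_I]
      ring
    rw [hI]
    push_cast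
    ring
  -- The factor √(t/r) in front of J₁ and the √(tr) extracted from J₁ multiply to t, so no square
  -- root of t or r survives.
  have hsq : ((√(t / r) : ℝ) : ℂ) * ((√(t * r) : ℝ) : ℂ) = t := by
    rw [← Complex.ofReal_mul, ← Real.sqrt_mul (by positivity),
      show t / r * (t * r) = t ^ 2 by field_simp, Real.sqrt_sq ht]
  simp only [green, coords_smul, coords_add, coords_sub, besselJ_eq, harg, hs, Vfun]
  rw [pow_zero, one_mul, pow_one, ← hrdef, ← hq]
  have hβ' : (β : ℂ) ≠ 0 := by exact_mod_cast hβ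
  have hq' : (q : ℂ) ≠ 0 := by exact_mod_cast hq0.ne'
  generalize besselE 1 (Complex.I * r / β * (Complex.I * t / ((β * √(ε * μ) : ℝ) : ℂ))) = e1
  generalize besselE 0 (Complex.I * r / β * (Complex.I * t / ((β * √(ε * μ) : ℝ) : ℂ))) = e0
  congr 1
  rw [hqa]
  have key : Complex.I * Theta ((1 / β : ℝ) : ℂ) x / ((β * q : ℝ) : ℂ) * ((√(t / r) : ℝ) : ℂ) *
      (((√(t * r) / (β * q) : ℝ) : ℂ) * e1) =
      1 / β * (Complex.I * t / ((β * q ^ 2 : ℝ) : ℂ) * e1) * Theta ((1 / β : ℝ) : ℂ) x := by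
    rw [← hsq]
    push_cast
    field_simp
  rw [key]
  ring

theorem green_of_neg (β ε μ : ℝ) {t : ℝ} (ht : t < 0) (x : E3) : green β ε μ (t, x) = 0 := by
  refine BQ.ext_coords fun m => ?_
  simp [green, heaviside, not_le.2 ht]

/-! ### The regularized inverse Fourier transform -/

/-- The height y enters only through e^{ipt} = e^{−yt}e^{it/b}: the constant A and both coefficients
do not depend on it. So the integral is known exactly for every y > 0, not merely in the limit. -/
theorem hasInverseFourier_FourierGreen (β ε μ : ℝ) (hβ : β ≠ 0) (hεμ : 0 < ε * μ) {t : ℝ}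
    (ht : t ≠ 0) (x : E3) {y : ℝ} (hy : 0 < y) :
    HasInverseFourier
      (fun w : ℝ => FourierGreen β ε μ ((w : ℂ) - Complex.I * (y : ℂ)) x) t
      (Complex.exp (-(y * t)) • green β ε μ (t, x)) := by
  intro m
  have ha : 0 < √(ε * μ) := Real.sqrt_pos.2 hεμ
  have hb0 : β * √(ε * μ) ≠ 0 := mul_ne_zero hβ ha.ne'
  rw [coords_smul, coords_green β ε μ hβ hεμ]
  simp only [coords_smul, bqIntegral, coords_ofCoords]
  have hw0 : ∀ z : ℂ, ((β * √(ε * μ) : ℝ) : ℂ) * z - 1 ≠ 0 → alphaOf β ε μ z =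
      ((1 / β : ℝ) : ℂ) + 1 / (β * (((β * √(ε * μ) : ℝ) : ℂ) * z - 1)) := fun z => alphaOf_eq hβ
  simp only [FourierGreen, coords_smul]
  generalize β * √(ε * μ) = b at *
  have hb : (b : ℂ) ≠ 0 := by exact_mod_cast hb0
  have hβ' : (β : ℂ) ≠ 0 := by exact_mod_cast hβ
  -- With z = w − iy, the equation bz = 1 reads w = p, a point above the real axis.
  set p : ℂ := 1 / b + Complex.I * y with hp
  have him : 0 < p.im := by
    rw [hp, ← Complex.ofReal_one, ← Complex.ofReal_div]
    simpa using hy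
  have hbz : ∀ w : ℝ, (b : ℂ) * ((w : ℂ) - Complex.I * y) - 1 = b * ((w : ℂ) - p) := fun w => by
    rw [hp]; field_simp; ring
  have hne := sub_ne_zero_of_im_pos him
  set A : ℂ := Complex.I * ‖x‖ / (β * b) with hA
  set k := coords (Kfun ((1 / β : ℝ) : ℂ) x) m
  set v := coords (Vfun ((1 / β : ℝ) : ℂ) x) m
  have hG : ∀ w : ℝ, Complex.exp (Complex.I * w * t) *
      (1 / (((b : ℂ) * ((w : ℂ) - Complex.I * y) - 1) * Complex.I) *
        coords (Kfun (alphaOf β ε μ ((w : ℂ) - Complex.I * y)) x) m) =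
      k / (b * Complex.I) * (Complex.exp (Complex.I * w * t) *
        (Complex.exp (A / ((w : ℂ) - p)) * ((w : ℂ) - p)⁻¹)) +
      v / (β * b * (b * Complex.I)) * (Complex.exp (Complex.I * w * t) *
        (Complex.exp (A / ((w : ℂ) - p)) * (((w : ℂ) - p) ^ 2)⁻¹)) := by
    intro w
    have h1 := hne w
    rw [hw0 _ (by rw [hbz]; exact mul_ne_zero hb h1), coords_Kfun_add, hbz]
    have h2 : Complex.I * (1 / (β * (b * ((w : ℂ) - p)))) * ‖x‖ = A / ((w : ℂ) - p) := by
      rw [hA]; field_simp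
    rw [h2, show coords (Kfun ((1 / β : ℝ) : ℂ) x) m = k from rfl,
      show coords (Vfun ((1 / β : ℝ) : ℂ) x) m = v from rfl]
    field_simp
  simp only [hG]
  have hE : Continuous fun w : ℝ => Complex.exp (Complex.I * w * t) := by fun_prop
  have hinv : Continuous fun w : ℝ => ((w : ℂ) - p)⁻¹ := by
    simpa using continuous_inv_sub_pow him 1
  have hX : Continuous fun w : ℝ => Complex.exp (A / ((w : ℂ) - p)) := by
    simp only [div_eq_mul_inv]; fun_prop
  have hion : ∀ {g : ℝ → ℂ}, Continuous g → ∀ R : ℝ × ℝ, IntegrableOn g (Set.Ioc (-R.1) R.2) :=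
    fun hg R => (hg.integrableOn_Icc (a := -R.1) (b := R.2)).mono_set Set.Ioc_subset_Icc_self
  have hsplit : ∀ R : ℝ × ℝ, ∫ w in Set.Ioc (-R.1) R.2, (k / (b * Complex.I) *
      (Complex.exp (Complex.I * w * t) * (Complex.exp (A / ((w : ℂ) - p)) * ((w : ℂ) - p)⁻¹)) +
      v / (β * b * (b * Complex.I)) * (Complex.exp (Complex.I * w * t) *
        (Complex.exp (A / ((w : ℂ) - p)) * (((w : ℂ) - p) ^ 2)⁻¹))) =
      k / (b * Complex.I) * (∫ w in Set.Ioc (-R.1) R.2, Complex.exp (Complex.I * w * t) *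
        (Complex.exp (A / ((w : ℂ) - p)) * ((w : ℂ) - p)⁻¹)) +
      v / (β * b * (b * Complex.I)) * (∫ w in Set.Ioc (-R.1) R.2,
        Complex.exp (Complex.I * w * t) *
        (Complex.exp (A / ((w : ℂ) - p)) * (((w : ℂ) - p) ^ 2)⁻¹)) := by
    intro R
    rw [integral_add, integral_const_mul, integral_const_mul]
    · exact (hion (hE.mul (hX.mul hinv)) R).const_mul _
    · exact (hion (hE.mul (hX.mul (continuous_inv_sub_pow him 2))) R).const_mul _
  simp only [hsplit]
  have hlim := (((tendsto_integral_cexp_div him ht A).const_mul (k / (b * Complex.I))).add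
    ((tendsto_integral_cexp_div_sq him t A).const_mul (v / (β * b * (b * Complex.I))))).const_mul
    (((1 / (2 * Real.pi) : ℝ) : ℂ))
  convert hlim using 2
  have hs : Complex.I * ‖x‖ / β * (Complex.I * t / b) = A * (Complex.I * t) := by
    rw [hA]; field_simp
  have hexp : Complex.exp (Complex.I * p * t) =
      Complex.exp (-(y * t)) * Complex.exp (Complex.I * t / b) := by
    rw [← Complex.exp_add, hp]
    congr 1
    field_simp
    linear_combination (b * y * t : ℂ) * Complex.I_sq
  rw [hs, hexp]
  have hπ : (Real.pi : ℂ) ≠ 0 := by exact_mod_cast Real.pi_ne_zero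
  push_cast
  field_simp

theorem regularized_inverse_Fourier (β ε μ : ℝ) (hβ : β ≠ 0) (hεμ : 0 < ε * μ) (t : ℝ) (x : E3)
    (ht : t ≠ 0) :
    ∃ fy : ℝ → BQ,
      (∀ y : ℝ, 0 < y → HasInverseFourier
        (fun w : ℝ => FourierGreen β ε μ ((w : ℂ) - Complex.I * (y : ℂ)) x) t (fy y)) ∧
      BQTendsto fy (𝓝[>] (0 : ℝ)) (green β ε μ (t, x)) := by
  refine ⟨fun y => Complex.exp (-(y * t)) • green β ε μ (t, x), fun y hy =>
    hasInverseFourier_FourierGreen β ε μ hβ hεμ ht x hy, fun m => ?_⟩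
  simp only [coords_smul]
  have h : Continuous fun y : ℝ => Complex.exp (-(y * t)) * coords (green β ε μ (t, x)) m := by
    fun_prop
  have h0 := h.tendsto 0
  simp only [Complex.ofReal_zero, zero_mul, neg_zero, Complex.exp_zero, one_mul] at h0
  exact h0.mono_left nhdsWithin_le_nhds

/-! ### Means over the unit circle -/

theorem circle_ne_zero (θ : ℝ) : circleMap 0 1 θ ≠ 0 := circleMap_ne_center one_ne_zero

theorem norm_circle (θ : ℝ) : ‖circleMap 0 1 θ‖ = 1 := by simp

theorem continuous_circle_inv : Continuous fun θ => (circleMap 0 1 θ)⁻¹ :=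
  (continuous_circleMap 0 1).inv₀ circle_ne_zero

/-- Cauchy's formula for the n-th derivative of e^{Bz} at 0. -/
theorem integral_circle_cexp_mul_inv_pow (B : ℂ) (n : ℕ) :
    ∫ θ in Set.Ioc 0 (2 * Real.pi), Complex.exp (B * circleMap 0 1 θ) * (circleMap 0 1 θ)⁻¹ ^ n
      = 2 * Real.pi * (B ^ n / n.factorial) := by
  have h := DifferentiableOn.circleIntegral_one_div_sub_center_pow_smul (c := 0) (R := 1)
    (f := fun z => Complex.exp (B * z)) one_pos n (by fun_prop)
  rw [iteratedDeriv_cexp_const_mul, circleIntegral,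
    intervalIntegral.integral_of_le (by positivity)] at h
  have h1 : ∀ θ, deriv (circleMap 0 1) θ • ((1 / (circleMap 0 1 θ - 0) ^ (n + 1)) •
      Complex.exp (B * circleMap 0 1 θ)) =
      Complex.I * (Complex.exp (B * circleMap 0 1 θ) * (circleMap 0 1 θ)⁻¹ ^ n) := by
    intro θ
    have h0 := circle_ne_zero θ
    simp only [deriv_circleMap, sub_zero, smul_eq_mul, inv_pow, pow_succ]
    field_simp
  simp only [h1] at h
  rw [integral_const_mul] at h
  refine mul_left_cancel₀ Complex.I_ne_zero (h.trans ?_)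
  simp
  ring

theorem integral_circle_mul_cexp (B : ℂ) :
    ∫ θ in Set.Ioc 0 (2 * Real.pi), circleMap 0 1 θ * Complex.exp (B * circleMap 0 1 θ) = 0 := by
  have h : ∮ z in C(0, 1), Complex.exp (B * z) = 0 := by
    refine Complex.circleIntegral_eq_zero_of_differentiable_on_off_countable zero_le_one
      Set.countable_empty (by fun_prop) fun z _ => by fun_prop
  rw [circleIntegral, intervalIntegral.integral_of_le (by positivity)] at h
  have h1 : ∀ θ, deriv (circleMap 0 1) θ • Complex.exp (B * circleMap 0 1 θ) =
      Complex.I * (circleMap 0 1 θ * Complex.exp (B * circleMap 0 1 θ)) := by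
    intro θ
    simp only [deriv_circleMap, smul_eq_mul]
    ring
  simp only [h1] at h
  rw [integral_const_mul] at h
  exact (mul_eq_zero.1 h).resolve_left Complex.I_ne_zero

theorem integrableOn_circle {g : ℝ → ℂ} (hg : Continuous g) :
    IntegrableOn g (Set.Ioc 0 (2 * Real.pi)) :=
  (hg.integrableOn_Icc).mono_set Set.Ioc_subset_Icc_self

/-- Expand e^{A/w}: its m-th term selects the coefficient of w^{m+k} in e^{Bw}, and the products of
coefficients form the Bessel series. Since |w| = 1, the series is dominated by that of e^{‖A‖}. -/
theorem integral_circle_cexp_cexp (A B : ℂ) (k : ℕ) :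
    ∫ θ in Set.Ioc 0 (2 * Real.pi), Complex.exp (A * (circleMap 0 1 θ)⁻¹) *
      (Complex.exp (B * circleMap 0 1 θ) * (circleMap 0 1 θ)⁻¹ ^ k)
      = 2 * Real.pi * (B ^ k * besselE k (A * B)) := by
  have hinv := continuous_circle_inv
  have hc := continuous_circleMap 0 1
  let F : ℕ → ℝ → ℂ := fun m θ => A ^ m / m.factorial *
    (Complex.exp (B * circleMap 0 1 θ) * (circleMap 0 1 θ)⁻¹ ^ (m + k))
  have hF : ∀ m, Continuous (F m) := fun m => by simp only [F]; fun_prop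
  have hsum : ∀ θ, HasSum (fun m => F m θ) (Complex.exp (A * (circleMap 0 1 θ)⁻¹) *
      (Complex.exp (B * circleMap 0 1 θ) * (circleMap 0 1 θ)⁻¹ ^ k)) := by
    intro θ
    have h := NormedSpace.expSeries_div_hasSum_exp (𝔸 := ℂ) (A * (circleMap 0 1 θ)⁻¹)
    rw [← Complex.exp_eq_exp_ℂ] at h
    have e : ∀ m : ℕ, F m θ = (A * (circleMap 0 1 θ)⁻¹) ^ m / m.factorial *
        (Complex.exp (B * circleMap 0 1 θ) * (circleMap 0 1 θ)⁻¹ ^ k) := fun m => by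
      simp only [F]
      rw [mul_pow, pow_add]
      ring
    simp only [e]
    exact h.mul_right _
  have hle : ∀ m θ, ‖F m θ‖ ≤ ‖A‖ ^ m / m.factorial * Real.exp ‖B‖ := by
    intro m θ
    simp only [F]
    rw [norm_mul, norm_mul, norm_pow _ (m + k), norm_inv, norm_circle, inv_one, one_pow, mul_one,
      norm_div, norm_pow, Complex.norm_natCast, Complex.norm_exp]
    gcongr
    exact (Complex.re_le_norm _).trans (by rw [norm_mul, norm_circle, mul_one])
  have hint : ∀ m, IntegrableOn (F m) (Set.Ioc 0 (2 * Real.pi)) := fun m =>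
    integrableOn_circle (hF m)
  have key := hasSum_integral_of_summable_integral_norm hint (by
    refine Summable.of_nonneg_of_le (fun m => integral_nonneg fun _ => norm_nonneg _)
      (fun m => integral_mono (hint m).norm (integrable_const _) (hle m)) ?_
    simp only [integral_const]
    exact ((Real.summable_pow_div_factorial ‖A‖).mul_right _).mul_left _)
  simp only [(hsum _).tsum_eq] at key
  rw [← key.tsum_eq, besselE, ← tsum_mul_left, ← tsum_mul_left]
  congr 1
  ext m
  simp only [F]
  rw [integral_const_mul, integral_circle_cexp_mul_inv_pow, mul_pow, pow_add]
  have h1 : (m.factorial : ℂ) ≠ 0 := by exact_mod_cast Nat.factorial_ne_zero m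
  have h2 : ((m + k).factorial : ℂ) ≠ 0 := by exact_mod_cast Nat.factorial_ne_zero (m + k)
  field_simp

/-! ### Integrals of biquaternion-valued functions -/

theorem coords_bqIntegral {X : Type*} [MeasurableSpace X] (ν : Measure X) (g : X → BQ)
    (m : Fin 4) : coords (bqIntegral ν g) m = ∫ p, coords (g p) m ∂ν := by
  simp [bqIntegral]

/-- Coordinatewise integrability. -/
def BQIntegrable {X : Type*} [MeasurableSpace X] (ν : Measure X) (g : X → BQ) : Prop :=
  ∀ m, Integrable (fun p => coords (g p) m) ν

/-- Left multiplication acts on coordinates as a constant complex matrix, which is what lets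
quaternionic factors pass through coordinatewise integrals. -/
theorem exists_coords_mul (p : BQ) :
    ∃ c : Fin 4 → Fin 4 → ℂ, ∀ (q : BQ) m, coords (p * q) m = ∑ j, c m j * coords q j := by
  refine ⟨![![p.re, -p.imI, -p.imJ, -p.imK], ![p.imI, p.re, -p.imK, p.imJ],
    ![p.imJ, p.imK, p.re, -p.imI], ![p.imK, -p.imJ, p.imI, p.re]], fun q m => ?_⟩
  fin_cases m <;> simp [coords, Fin.sum_univ_four] <;> ring

section BQIntegral

variable {X : Type*} [MeasurableSpace X] {ν : Measure X} {g h : X → BQ}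

theorem BQIntegrable.add (hg : BQIntegrable ν g) (hh : BQIntegrable ν h) :
    BQIntegrable ν (fun p => g p + h p) := fun m => by
  simp only [coords_add]
  exact (hg m).add (hh m)

theorem BQIntegrable.sub (hg : BQIntegrable ν g) (hh : BQIntegrable ν h) :
    BQIntegrable ν (fun p => g p - h p) := fun m => by
  simp only [coords_sub]
  exact (hg m).sub (hh m)

theorem BQIntegrable.const_smul (hg : BQIntegrable ν g) (c : ℂ) :
    BQIntegrable ν (fun p => c • g p) := fun m => by
  simp only [coords_smul]
  exact (hg m).const_mul c

theorem BQIntegrable.const_mul (hg : BQIntegrable ν g) (q : BQ) :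
    BQIntegrable ν (fun p => q * g p) := fun m => by
  obtain ⟨c, hc⟩ := exists_coords_mul q
  simp only [hc]
  exact integrable_finsetSum _ fun j _ => (hg j).const_mul _

theorem bqIntegral_add (hg : BQIntegrable ν g) (hh : BQIntegrable ν h) :
    bqIntegral ν (fun p => g p + h p) = bqIntegral ν g + bqIntegral ν h := by
  refine BQ.ext_coords fun m => ?_
  simp only [coords_add, coords_bqIntegral]
  exact integral_add (hg m) (hh m)

theorem bqIntegral_sub (hg : BQIntegrable ν g) (hh : BQIntegrable ν h) :
    bqIntegral ν (fun p => g p - h p) = bqIntegral ν g - bqIntegral ν h := by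
  refine BQ.ext_coords fun m => ?_
  simp only [coords_sub, coords_bqIntegral]
  exact integral_sub (hg m) (hh m)

theorem bqIntegral_const_smul (c : ℂ) (g : X → BQ) :
    bqIntegral ν (fun p => c • g p) = c • bqIntegral ν g := by
  refine BQ.ext_coords fun m => ?_
  simp only [coords_smul, coords_bqIntegral]
  exact integral_const_mul _ _

theorem bqIntegral_const_mul (hg : BQIntegrable ν g) (q : BQ) :
    bqIntegral ν (fun p => q * g p) = q * bqIntegral ν g := by
  obtain ⟨c, hc⟩ := exists_coords_mul q
  refine BQ.ext_coords fun m => ?_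
  simp only [hc, coords_bqIntegral]
  rw [integral_finsetSum _ fun j _ => (hg j).const_mul _]
  simp only [integral_const_mul]

theorem BQIntegrable.sum_unit_mul {g : Fin 3 → X → BQ} (hg : ∀ k, BQIntegrable ν (g k)) :
    BQIntegrable ν (fun p => ∑ k, unit k * g k p) := by
  simp only [Fin.sum_univ_three]
  exact (((hg 0).const_mul _).add ((hg 1).const_mul _)).add ((hg 2).const_mul _)

theorem bqIntegral_sum_unit_mul {g : Fin 3 → X → BQ} (hg : ∀ k, BQIntegrable ν (g k)) :
    bqIntegral ν (fun p => ∑ k, unit k * g k p) = ∑ k, unit k * bqIntegral ν (g k) := by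
  simp only [Fin.sum_univ_three]
  rw [bqIntegral_add (((hg 0).const_mul _).add ((hg 1).const_mul _)) ((hg 2).const_mul _),
    bqIntegral_add ((hg 0).const_mul _) ((hg 1).const_mul _), bqIntegral_const_mul (hg 0),
    bqIntegral_const_mul (hg 1), bqIntegral_const_mul (hg 2)]

end BQIntegral

/-! ### Slices of test functions -/

theorem IsTest.slice {Φ : Spacetime → ℂ} (h : IsTest Φ) (t : ℝ) : IsTest fun x => Φ (t, x) := by
  refine ⟨h.1.comp (contDiff_prodMk_right t), ?_⟩
  exact h.2.comp_isClosedEmbedding (Topology.IsClosedEmbedding.of_continuous_injective_isClosedMap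
    (by fun_prop) (Prod.mk_right_injective t) (isClosedMap_prodMk_left t))

theorem IsTest.fderiv_slice {Φ : Spacetime → ℂ} (h : IsTest Φ) (t : ℝ) (x : E3) (k : Fin 3) :
    fderiv ℝ (fun x => Φ (t, x)) x (dirE3 k) = fderiv ℝ Φ (t, x) (dirX k) := by
  have := (h.differentiable (t, x)).hasFDerivAt.comp x (hasFDerivAt_prodMk_right t x)
  rw [show (fun x => Φ (t, x)) = Φ ∘ fun x => (t, x) from rfl, this.fderiv]
  simp [dirX]

theorem IsTest.hasDerivAt_time {Φ : Spacetime → ℂ} (h : IsTest Φ) (t : ℝ) (x : E3) :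
    HasDerivAt (fun t => Φ (t, x)) (fderiv ℝ Φ (t, x) dirT) t := by
  have := ((h.differentiable (t, x)).hasFDerivAt.comp t
    (hasFDerivAt_prodMk_left t x)).hasDerivAt
  refine this.congr_deriv ?_
  simp [dirT]

theorem IsTest.hasCompactSupport_time {Φ : Spacetime → ℂ} (h : IsTest Φ) (x : E3) :
    HasCompactSupport fun t => Φ (t, x) :=
  h.2.comp_isClosedEmbedding (Topology.IsClosedEmbedding.of_continuous_injective_isClosedMap
    (by fun_prop) (Prod.mk_left_injective x) (isClosedMap_prodMk_right x))

/-! ### Causal exponentials -/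

/-- The function `H(t) exp(lt)`. -/
def causalExp (l : ℂ) (t : ℝ) : ℂ := heaviside t * Complex.exp (l * t)

/-- The function `H(t) exp(lt) K_α(x)`. -/
def Tfun (l α : ℂ) (p : Spacetime) : BQ := causalExp l p.1 • Kfun α p.2

theorem measurable_heaviside : Measurable heaviside :=
  Measurable.ite measurableSet_Ici measurable_const measurable_const

theorem measurable_causalExp : Measurable fun p : ℂ × ℝ => causalExp p.1 p.2 := by
  have h1 : Measurable fun p : ℂ × ℝ => ((heaviside p.2 : ℝ) : ℂ) :=
    Complex.measurable_ofReal.comp (measurable_heaviside.comp measurable_snd)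
  have h2 : Measurable fun p : ℂ × ℝ => Complex.exp (p.1 * p.2) := by fun_prop
  exact h1.mul h2

theorem norm_causalExp_le {l : ℂ} {L R t : ℝ} (hl : ‖l‖ ≤ L) (ht : |t| ≤ R) :
    ‖causalExp l t‖ ≤ Real.exp (L * R) := by
  have h1 : ‖((heaviside t : ℝ) : ℂ)‖ ≤ 1 := by
    rw [heaviside]; split_ifs <;> simp
  rw [causalExp, norm_mul, Complex.norm_exp]
  refine (mul_le_of_le_one_left (Real.exp_nonneg _) h1).trans (Real.exp_le_exp.2 ?_)
  refine (Complex.re_le_norm _).trans ?_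
  rw [norm_mul, Complex.norm_real, Real.norm_eq_abs]
  exact mul_le_mul hl ht (abs_nonneg _) ((norm_nonneg _).trans hl)

theorem helmBound_mono {α : ℂ} {C S : ℝ} (hα : ‖α‖ ≤ C) (hS : 0 ≤ S) :
    (‖α‖ + 1) * helmBound α S ≤ (C + 1) * ((C * S + S + 1) * Real.exp (C * S)) := by
  have h0 := norm_nonneg α
  have hC : 0 ≤ C := h0.trans hα
  have h1 : 0 ≤ C + 1 := by linarith
  have h2 : 0 ≤ C * S + S + 1 := by positivity
  unfold helmBound
  gcongr

/-- The majorant is uniform in the wave number, as Fubini over the circle requires. The absolute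
value in it ensures nonnegativity whatever the signs of C and R. -/
theorem exists_bound_Kfun (C R : ℝ) : ∃ g : E3 → ℝ, Integrable g ∧ (∀ x, 0 ≤ g x) ∧
    ∀ α : ℂ, ‖α‖ ≤ C → ∀ x : E3, ‖x‖ ≤ R → ∀ m, ‖coords (Kfun α x) m‖ ≤ g x := by
  refine ⟨(Metric.closedBall (0 : E3) R).indicator fun x =>
    |(C + 1) * ((C * R + R + 1) * Real.exp (C * R))| * (‖x‖ ^ 2)⁻¹, ?_, fun x => ?_,
    fun α hα x hx m => ?_⟩
  · rw [integrable_indicator_iff measurableSet_closedBall]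
    exact (integrableOn_inv_norm_sq R).const_mul _
  · exact Set.indicator_nonneg (fun x _ => by positivity) x
  · rw [Set.indicator_of_mem (by simpa using hx)]
    refine (norm_coords_Kfun_le α hx m).trans ?_
    gcongr
    exact (helmBound_mono hα ((norm_nonneg x).trans hx)).trans (le_abs_self _)

theorem exists_bound_Tfun (L C R : ℝ) : ∃ g : Spacetime → ℝ, Integrable g ∧ (∀ p, 0 ≤ g p) ∧
    ∀ l α : ℂ, ‖l‖ ≤ L → ‖α‖ ≤ C → ∀ p : Spacetime, |p.1| ≤ R → ‖p.2‖ ≤ R → ∀ m,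
      ‖coords (Tfun l α p) m‖ ≤ g p := by
  obtain ⟨g, hg, hg0, hgb⟩ := exists_bound_Kfun C R
  have hI : Integrable ((Set.Icc (-R) R).indicator fun _ : ℝ => Real.exp (L * R)) :=
    (integrable_indicator_iff measurableSet_Icc).2 (integrableOn_const (by simp))
  refine ⟨fun p => (Set.Icc (-R) R).indicator (fun _ : ℝ => Real.exp (L * R)) p.1 * g p.2,
    hI.mul_prod hg, fun p => mul_nonneg (Set.indicator_nonneg (fun _ _ => (Real.exp_nonneg _)) _)
      (hg0 _), fun l α hl hα p h1 h2 m => ?_⟩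
  dsimp only
  rw [Set.indicator_of_mem (show p.1 ∈ Set.Icc (-R) R from abs_le.1 h1), Tfun, coords_smul, norm_mul]
  exact mul_le_mul (norm_causalExp_le hl h1) (hgb α hα p.2 h2 m) (norm_nonneg _)
    (Real.exp_nonneg _)

theorem exists_bound_test_mul_Tfun (L C : ℝ) {Φ : Spacetime → ℂ} (hΦ : IsTest Φ) :
    ∃ g : Spacetime → ℝ, Integrable g ∧ ∀ l α : ℂ, ‖l‖ ≤ L → ‖α‖ ≤ C → ∀ p m,
      ‖Φ p * coords (Tfun l α p) m‖ ≤ g p := by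
  obtain ⟨R, hR, hsupp⟩ := HasCompactSupport.exists_radius hΦ.2
  obtain ⟨M, hM0, hM⟩ := HasCompactSupport.exists_norm_le hΦ.2 hΦ.continuous
  obtain ⟨g, hg, hg0, hgb⟩ := exists_bound_Tfun L C R
  refine ⟨fun p => M * g p, hg.const_mul M, fun l α hl hα p m => ?_⟩
  by_cases hp : ‖p‖ ≤ R
  · rw [norm_mul]
    exact mul_le_mul (hM p) (hgb l α hl hα p ((norm_fst_le p).trans hp)
      ((norm_snd_le p).trans hp) m) (norm_nonneg _) hM0
  · rw [hsupp p (not_le.1 hp), zero_mul, norm_zero]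
    exact mul_nonneg hM0 (hg0 p)

theorem measurable_coords_Tfun {Ω : Type*} [MeasurableSpace Ω] {l α : Ω → ℂ} (hl : Measurable l)
    (hα : Measurable α) (m : Fin 4) :
    Measurable fun q : Ω × Spacetime => coords (Tfun (l q.1) (α q.1) q.2) m := by
  have e1 : Measurable fun q : Ω × Spacetime => (l q.1, q.2.1) := by fun_prop
  have e2 : Measurable fun q : Ω × Spacetime => (α q.1, q.2.2) := by fun_prop
  have h1 := measurable_causalExp.comp e1
  have h2 := (measurable_coords_Kfun m).comp e2
  simp only [Function.comp_def] at h1 h2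
  simp only [Tfun, coords_smul]
  exact h1.mul h2

theorem measurable_coords_Tfun' (l α : ℂ) (m : Fin 4) :
    Measurable fun p : Spacetime => coords (Tfun l α p) m := by
  have e : Measurable fun p : Spacetime => (l, p) := by fun_prop
  have h := (measurable_coords_Tfun (Ω := ℂ) measurable_id (measurable_const (a := α)) m).comp e
  simp only [Function.comp_def, id] at h
  exact h

theorem integrable_test_mul_Tfun (l α : ℂ) {Φ : Spacetime → ℂ} (hΦ : IsTest Φ) (m : Fin 4) :
    Integrable fun p => Φ p * coords (Tfun l α p) m := by
  obtain ⟨g, hg, hb⟩ := exists_bound_test_mul_Tfun ‖l‖ ‖α‖ hΦ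
  exact hg.mono' (hΦ.continuous.measurable.mul (measurable_coords_Tfun' l α m)).aestronglyMeasurable
    (Eventually.of_forall fun p => hb l α le_rfl le_rfl p m)

theorem causalExp_eq_indicator (l : ℂ) :
    causalExp l = (Set.Ici 0).indicator fun t : ℝ => Complex.exp (l * t) := by
  ext t
  rw [causalExp, heaviside]
  by_cases h : 0 ≤ t
  · rw [if_pos h, Set.indicator_of_mem (Set.mem_Ici.2 h)]; simp
  · rw [if_neg h, Set.indicator_of_notMem (by simpa using h)]; simp

theorem integral_mul_causalExp (l : ℂ) (f : ℝ → ℂ) :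
    ∫ t, f t * causalExp l t = ∫ t in Set.Ioi 0, f t * Complex.exp (l * t) := by
  rw [← integral_Ici_eq_integral_Ioi, ← integral_indicator measurableSet_Ici,
    causalExp_eq_indicator]
  congr 1
  ext t
  by_cases h : t ∈ Set.Ici (0 : ℝ)
  · simp [Set.indicator_of_mem h]
  · simp [Set.indicator_of_notMem h]

/-- This is (H e^{lt})' = δ + l H e^{lt}; the delta is the boundary term at 0 of an integration by
parts on the half-line. -/
theorem integral_deriv_time_mul_causalExp (l : ℂ) {Φ : Spacetime → ℂ} (hΦ : IsTest Φ) (x : E3) :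
    ∫ t, fderiv ℝ Φ (t, x) dirT * causalExp l t
      = -Φ (0, x) - l * ∫ t, Φ (t, x) * causalExp l t := by
  rw [integral_mul_causalExp l fun t => fderiv ℝ Φ (t, x) dirT,
    integral_mul_causalExp l fun t => Φ (t, x)]
  have hE : ∀ t : ℝ, HasDerivAt (fun t : ℝ => Complex.exp (l * t)) (Complex.exp (l * t) * l) t := by
    intro t
    have h := (Complex.ofRealCLM.hasDerivAt (x := t)).const_mul l
    exact h.cexp.congr_deriv (by simp)
  have hd : ∀ t, HasDerivAt (fun t => Φ (t, x) * Complex.exp (l * t))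
      (fderiv ℝ Φ (t, x) dirT * Complex.exp (l * t) + Φ (t, x) * (Complex.exp (l * t) * l)) t :=
    fun t => (hΦ.hasDerivAt_time t x).mul (hE t)
  have hcs := hΦ.hasCompactSupport_time x
  have hcs' := (hΦ.fderiv_apply dirT).hasCompactSupport_time x
  have hc0 : Continuous fun t => Φ (t, x) := hΦ.continuous.comp (by fun_prop)
  have hc1 : Continuous fun t => fderiv ℝ Φ (t, x) dirT :=
    (hΦ.fderiv_apply dirT).continuous.comp (f := fun t => (t, x)) (by fun_prop)
  have hce : Continuous fun t : ℝ => Complex.exp (l * t) := by fun_prop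
  have hi1 : Integrable fun t : ℝ => fderiv ℝ Φ (t, x) dirT * Complex.exp (l * t) :=
    (hc1.mul hce).integrable_of_hasCompactSupport hcs'.mul_right
  have hi2 : Integrable fun t : ℝ => Φ (t, x) * (Complex.exp (l * t) * l) :=
    (hc0.mul (hce.mul continuous_const)).integrable_of_hasCompactSupport hcs.mul_right
  have hlim : Tendsto (fun t => Φ (t, x) * Complex.exp (l * t)) atTop (𝓝 0) := by
    have h : HasCompactSupport fun t : ℝ => Φ (t, x) * Complex.exp (l * t) := hcs.mul_right
    exact (h.is_zero_at_infty).mono_left atTop_le_cocompact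
  have h := integral_Ioi_of_hasDerivAt_of_tendsto' (a := 0) (fun t _ => hd t)
    (hi1.add hi2).integrableOn hlim
  rw [integral_add hi1.integrableOn hi2.integrableOn] at h
  have h2 : ∫ t : ℝ in Set.Ioi 0, Φ (t, x) * (Complex.exp (l * t) * l)
      = l * ∫ t : ℝ in Set.Ioi 0, Φ (t, x) * Complex.exp (l * t) := by
    rw [← integral_const_mul]; congr 1; ext t; ring
  rw [h2] at h
  simp only [Complex.ofReal_zero, mul_zero, Complex.exp_zero, mul_one, zero_sub] at h
  linear_combination h

/-! ### The chiral operator on causal exponentials -/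

theorem regular_Tfun_eq (l α : ℂ) {Φ : Spacetime → ℂ} (hΦ : IsTest Φ) :
    BQIntegrable volume (fun t => causalExp l t • regular (Kfun α) fun x => Φ (t, x)) ∧
    regular (Tfun l α) Φ
      = bqIntegral volume fun t => causalExp l t • regular (Kfun α) fun x => Φ (t, x) := by
  have h : ∀ m t, ∫ x, Φ (t, x) * coords (Tfun l α (t, x)) m =
      coords (causalExp l t • regular (Kfun α) fun x => Φ (t, x)) m := by
    intro m t
    simp only [Tfun, coords_smul, coords_regular]
    rw [← integral_const_mul]
    congr 1; ext x; ring
  constructor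
  · intro m
    simp only [← h]
    exact (integrable_test_mul_Tfun l α hΦ m).integral_prod_left
  · refine BQ.ext_coords fun m => ?_
    rw [coords_regular, coords_bqIntegral, Measure.volume_eq_prod,
      integral_prod _ (integrable_test_mul_Tfun l α hΦ m)]
    simp only [h]

/-- The pairing of `H(t) exp(lt) δ(x)` with a test function. -/
def timePairing (l : ℂ) (Φ : Spacetime → ℂ) : ℂ := ∫ t, Φ (t, 0) * causalExp l t

/-- On each time slice DK_α = δ − αK_α applies; integrating in time against H(t)e^{lt} gives DT =
H(t)e^{lt}δ(x) − αT. -/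
theorem sum_unit_mul_regular_Tfun (l α : ℂ) {Φ : Spacetime → ℂ} (hΦ : IsTest Φ) :
    ∑ k, unit k * regular (Tfun l α) (fun p => fderiv ℝ Φ p (dirX k))
      = α • regular (Tfun l α) Φ - timePairing l Φ • (1 : BQ) := by
  have hk := fun k => regular_Tfun_eq l α (hΦ.fderiv_apply (dirX k))
  obtain ⟨h1, h2⟩ := regular_Tfun_eq l α hΦ
  have hpt : ∀ t, ∑ k, unit k * (causalExp l t • regular (Kfun α)
      fun x => fderiv ℝ Φ (t, x) (dirX k)) =
      α • (causalExp l t • regular (Kfun α) fun x => Φ (t, x)) -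
        (Φ (t, 0) * causalExp l t) • (1 : BQ) := by
    intro t
    have h := sum_unit_mul_regular_Kfun α (hΦ.slice t)
    simp only [hΦ.fderiv_slice] at h
    have hc : ∀ p q : BQ, p * causalExp l t • q = causalExp l t • (p * q) := fun p q =>
      Algebra.mul_smul_comm _ _ _
    have h' : ∀ m, coords (∑ k, unit k * regular (Kfun α)
        fun x => fderiv ℝ Φ (t, x) (dirX k)) m = _ := fun m => by rw [h]
    simp only [hc, Fin.sum_univ_three] at h' ⊢
    refine BQ.ext_coords fun m => ?_
    have := h' m
    simp only [coords_add, coords_sub, coords_smul] at this ⊢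
    linear_combination causalExp l t * this
  have hJ : Integrable fun t => Φ (t, 0) * causalExp l t := by
    have hm : Measurable (causalExp l) :=
      measurable_causalExp.comp (measurable_const.prodMk measurable_id)
    obtain ⟨R, hR, hsupp⟩ := HasCompactSupport.exists_radius (hΦ.hasCompactSupport_time 0)
    have hc : Continuous fun t : ℝ => Φ (t, 0) := hΦ.continuous.comp (by fun_prop)
    have hi : Integrable fun t : ℝ => Φ (t, 0) :=
      hc.integrable_of_hasCompactSupport (hΦ.hasCompactSupport_time 0)
    refine (hi.norm.mul_const (Real.exp (‖l‖ * R))).mono'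
      (hc.measurable.mul hm).aestronglyMeasurable (Eventually.of_forall fun t => ?_)
    rw [norm_mul]
    by_cases ht : ‖t‖ ≤ R
    · gcongr
      exact norm_causalExp_le le_rfl ht
    · rw [hsupp t (not_le.1 ht)]; simp
  have hJ' : BQIntegrable volume fun t => (Φ (t, 0) * causalExp l t) • (1 : BQ) := fun m => by
    simp only [coords_smul]
    exact hJ.mul_const _
  have hJv : bqIntegral volume (fun t => (Φ (t, 0) * causalExp l t) • (1 : BQ)) =
      timePairing l Φ • (1 : BQ) := by
    refine BQ.ext_coords fun m => ?_
    rw [coords_bqIntegral]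
    simp only [coords_smul, timePairing]
    rw [integral_mul_const]
  simp only [(hk _).2]
  rw [← bqIntegral_sum_unit_mul fun k => (hk k).1]
  simp only [hpt]
  rw [bqIntegral_sub (h1.const_smul α) hJ', bqIntegral_const_smul, h2, hJv]

theorem regular_Tfun_deriv_time (l α : ℂ) {Φ : Spacetime → ℂ} (hΦ : IsTest Φ) :
    regular (Tfun l α) (fun p => fderiv ℝ Φ p dirT)
      = -regular (Kfun α) (fun x => Φ (0, x)) - l • regular (Tfun l α) Φ := by
  refine BQ.ext_coords fun m => ?_
  have h1 := integrable_test_mul_Tfun l α (hΦ.fderiv_apply dirT) m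
  have h2 := integrable_test_mul_Tfun l α hΦ m
  simp only [coords_sub, coords_neg, coords_smul, coords_regular]
  rw [Measure.volume_eq_prod] at h1 h2 ⊢
  rw [integral_prod_symm _ h1, integral_prod_symm _ h2, ← integral_const_mul, ← integral_neg,
    ← integral_sub]
  · congr 1
    ext x
    have hx := integral_deriv_time_mul_causalExp l hΦ x
    simp only [Tfun, coords_smul, ← mul_assoc]
    rw [integral_mul_const, integral_mul_const, hx]
    ring
  · have h3 := (locallyIntegrable_Kfun α m).integrable_smul_left_of_hasCompactSupport
      (hΦ.slice 0).continuous (hΦ.slice 0).2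
    exact h3.neg
  · exact h2.integral_prod_right.const_mul l

theorem timePairing_deriv_time (l : ℂ) {Φ : Spacetime → ℂ} (hΦ : IsTest Φ) :
    timePairing l (fun p => fderiv ℝ Φ p dirT) = -Φ 0 - l * timePairing l Φ :=
  integral_deriv_time_mul_causalExp l hΦ 0

theorem chiralM_regular (β ε μ : ℝ) (g : Spacetime → BQ) (φ : Spacetime → ℂ) :
    chiralM β ε μ (regular g) φ =
      ((β * √(ε * μ) : ℝ) : ℂ) • (∑ k, unit k *
          regular g (fun p => fderiv ℝ (fun p => fderiv ℝ φ p dirT) p (dirX k)))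
        - ((√(ε * μ) : ℝ) : ℂ) • regular g (fun p => fderiv ℝ φ p dirT)
        + Complex.I • ∑ k, unit k * regular g (fun p => fderiv ℝ φ p (dirX k)) := by
  have h : distDeriv dirT (distD dirX (regular g)) φ =
      -distD dirX (regular g) (fun p => fderiv ℝ φ p dirT) := rfl
  have h' : distDeriv dirT (regular g) φ = -regular g (fun p => fderiv ℝ φ p dirT) := rfl
  rw [chiralM, h, h', distD_regular, distD_regular]
  refine BQ.ext_coords fun m => ?_
  simp only [coords_add, coords_sub, coords_smul, coords_neg]
  ring

/-- The coefficient of T in MT is al − α(bl − i), so the hypothesis is the dispersion relation that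
removes it. The jump at t = 0 and the singularity at x = 0 produce the three remaining terms. -/
theorem chiralM_Tfun (β ε μ : ℝ) {l α : ℂ}
    (hα : α * (((β * √(ε * μ) : ℝ) : ℂ) * l - Complex.I) = ((√(ε * μ) : ℝ) : ℂ) * l)
    {φ : Spacetime → ℂ} (hφ : IsTest φ) :
    chiralM β ε μ (regular (Tfun l α)) φ =
      (((β * √(ε * μ) : ℝ) : ℂ) * φ 0) • (1 : BQ)
        + (((√(ε * μ) : ℝ) : ℂ) - ((β * √(ε * μ) : ℝ) : ℂ) * α) •
          regular (Kfun α) (fun x => φ (0, x))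
        + ((((β * √(ε * μ) : ℝ) : ℂ) * l - Complex.I) * timePairing l φ) • (1 : BQ) := by
  rw [chiralM_regular, sum_unit_mul_regular_Tfun l α hφ,
    sum_unit_mul_regular_Tfun l α (hφ.fderiv_apply dirT), regular_Tfun_deriv_time l α hφ,
    timePairing_deriv_time l hφ]
  refine BQ.ext_coords fun m => ?_
  simp only [coords_add, coords_sub, coords_smul, coords_neg]
  linear_combination (-coords (regular (Tfun l α) φ) m) * hα

/-! ### The Green function as a mean of causal exponentials -/

/-- Lebesgue measure on the parameter interval of the unit circle. -/
def circleMeasure : Measure ℝ := volume.restrict (Set.Ioc 0 (2 * Real.pi))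

instance : IsFiniteMeasure circleMeasure := by
  unfold circleMeasure; infer_instance

/-- The wave number `1/β + 1/(βw)` at the point `w` of the unit circle. -/
def circleAlpha (β θ : ℝ) : ℂ := ((1 / β : ℝ) : ℂ) + 1 / β * (circleMap 0 1 θ)⁻¹

/-- The rate `i(w + 1)/b` at the point `w` of the unit circle. -/
def circleRate (b θ : ℝ) : ℂ := Complex.I / b * (circleMap 0 1 θ + 1)

theorem continuous_circleAlpha (β : ℝ) : Continuous (circleAlpha β) := by
  have := continuous_circle_inv
  unfold circleAlpha
  fun_prop

theorem continuous_circleRate (b : ℝ) : Continuous (circleRate b) := by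
  have := continuous_circleMap 0 1
  unfold circleRate
  fun_prop

theorem norm_circleAlpha_le (β θ : ℝ) : ‖circleAlpha β θ‖ ≤ 2 / |β| := by
  refine (norm_add_le _ _).trans (le_of_eq ?_)
  rw [norm_mul, norm_inv, norm_circle]
  simp
  ring

theorem norm_circleRate_le (b θ : ℝ) : ‖circleRate b θ‖ ≤ 2 / |b| := by
  rw [circleRate, norm_mul, norm_div, Complex.norm_I, Complex.norm_real, Real.norm_eq_abs]
  have h : ‖circleMap 0 1 θ + 1‖ ≤ 2 := by
    refine (norm_add_le _ _).trans (le_of_eq ?_)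
    rw [norm_circle, norm_one]
    norm_num
  calc 1 / |b| * ‖circleMap 0 1 θ + 1‖ ≤ 1 / |b| * 2 := by gcongr
    _ = 2 / |b| := by ring

theorem coords_Tfun_circle (β b : ℝ) (hb : b ≠ 0) (θ t : ℝ) (x : E3) (m : Fin 4) :
    coords (Tfun (circleRate b θ) (circleAlpha β θ) (t, x)) m =
      heaviside t * Complex.exp (Complex.I * t / b) *
        (coords (Kfun ((1 / β : ℝ) : ℂ) x) m *
          (Complex.exp (Complex.I * ‖x‖ / β * (circleMap 0 1 θ)⁻¹) *
            (Complex.exp (Complex.I * t / b * circleMap 0 1 θ) * (circleMap 0 1 θ)⁻¹ ^ 0))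
        + 1 / β * coords (Vfun ((1 / β : ℝ) : ℂ) x) m *
          (Complex.exp (Complex.I * ‖x‖ / β * (circleMap 0 1 θ)⁻¹) *
            (Complex.exp (Complex.I * t / b * circleMap 0 1 θ) * (circleMap 0 1 θ)⁻¹ ^ 1))) := by
  have hb' : (b : ℂ) ≠ 0 := by exact_mod_cast hb
  have h1 : Complex.exp (circleRate b θ * t) =
      Complex.exp (Complex.I * t / b) * Complex.exp (Complex.I * t / b * circleMap 0 1 θ) := by
    rw [← Complex.exp_add, circleRate]
    congr 1
    ring
  have h2 : Complex.I * (1 / β * (circleMap 0 1 θ)⁻¹) * ‖x‖ =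
      Complex.I * ‖x‖ / β * (circleMap 0 1 θ)⁻¹ := by ring
  rw [Tfun, coords_smul, causalExp, circleAlpha, coords_Kfun_add, h1, h2]
  ring

/-- With z = (w + 1)/b one has bz − 1 = w and dz = iw dθ/b. For t ≥ 0 the right side is thus
(1/2π)∮F(z, x)e^{izt}dz on a circle around the essential singularity 1/b. -/
theorem coords_green_eq_mean (β ε μ : ℝ) (hβ : β ≠ 0) (hεμ : 0 < ε * μ) (p : Spacetime)
    (m : Fin 4) :
    coords (green β ε μ p) m = (2 * Real.pi * ((β * √(ε * μ) : ℝ) : ℂ))⁻¹ *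
      ∫ θ, coords (Tfun (circleRate (β * √(ε * μ)) θ) (circleAlpha β θ) p) m ∂circleMeasure := by
  obtain ⟨t, x⟩ := p
  have hb0 : β * √(ε * μ) ≠ 0 := mul_ne_zero hβ (Real.sqrt_pos.2 hεμ).ne'
  rw [coords_green β ε μ hβ hεμ]
  simp only [coords_Tfun_circle β _ hb0]
  have hinv := continuous_circle_inv
  have hc := continuous_circleMap 0 1
  have hb' : ((β * √(ε * μ) : ℝ) : ℂ) ≠ 0 := by exact_mod_cast hb0
  generalize ((β * √(ε * μ) : ℝ) : ℂ) = b at *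
  have hi : ∀ (c : ℂ) (k : ℕ), IntegrableOn (fun θ => c *
      (Complex.exp (Complex.I * ‖x‖ / β * (circleMap 0 1 θ)⁻¹) *
        (Complex.exp (Complex.I * t / b * circleMap 0 1 θ) * (circleMap 0 1 θ)⁻¹ ^ k)))
      (Set.Ioc 0 (2 * Real.pi)) := fun c k => integrableOn_circle (by fun_prop)
  rw [circleMeasure, integral_const_mul, integral_add (hi _ 0) (hi _ 1), integral_const_mul,
    integral_const_mul, integral_circle_cexp_cexp, integral_circle_cexp_cexp]
  have hπ : (Real.pi : ℂ) ≠ 0 := by exact_mod_cast Real.pi_ne_zero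
  rw [pow_zero, pow_one, one_mul]
  field_simp

theorem locallyIntegrable_green (β ε μ : ℝ) (hβ : β ≠ 0) (hεμ : 0 < ε * μ) :
    BQLocallyIntegrable volume (green β ε μ) := by
  intro m
  refine locallyIntegrable_of_closedBall fun R => ?_
  obtain ⟨g, hg, -, hb⟩ := exists_bound_Tfun (2 / |β * √(ε * μ)|) (2 / |β|) R
  have hm := measurable_coords_Tfun (continuous_circleRate (β * √(ε * μ))).measurable
    (continuous_circleAlpha β).measurable m
  have hball : ∀ p : Spacetime, p ∈ Metric.closedBall (0 : Spacetime) R → |p.1| ≤ R ∧ ‖p.2‖ ≤ R :=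
    fun p hp => by
      rw [mem_closedBall_zero_iff] at hp
      exact ⟨(norm_fst_le p).trans hp, (norm_snd_le p).trans hp⟩
  have hint : Integrable (fun q : ℝ × Spacetime =>
      coords (Tfun (circleRate (β * √(ε * μ)) q.1) (circleAlpha β q.1) q.2) m)
      (circleMeasure.prod (volume.restrict (Metric.closedBall 0 R))) := by
    refine (hg.integrableOn.comp_snd circleMeasure).mono' hm.aestronglyMeasurable ?_
    have hae : ∀ᵐ q ∂(circleMeasure.prod (volume.restrict (Metric.closedBall (0 : Spacetime) R))),
        q.2 ∈ Metric.closedBall (0 : Spacetime) R :=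
      Measure.quasiMeasurePreserving_snd.ae (ae_restrict_mem measurableSet_closedBall)
    filter_upwards [hae] with q hq
    exact hb _ _ (norm_circleRate_le _ _) (norm_circleAlpha_le _ _) q.2 (hball _ hq).1
      (hball _ hq).2 m
  simp only [coords_green_eq_mean β ε μ hβ hεμ]
  exact hint.integral_prod_right.const_mul _

theorem regular_green_eq_mean (β ε μ : ℝ) (hβ : β ≠ 0) (hεμ : 0 < ε * μ) {Φ : Spacetime → ℂ}
    (hΦ : IsTest Φ) :
    BQIntegrable circleMeasure (fun θ =>
      regular (Tfun (circleRate (β * √(ε * μ)) θ) (circleAlpha β θ)) Φ) ∧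
    regular (green β ε μ) Φ = (2 * Real.pi * ((β * √(ε * μ) : ℝ) : ℂ))⁻¹ •
      bqIntegral circleMeasure fun θ =>
        regular (Tfun (circleRate (β * √(ε * μ)) θ) (circleAlpha β θ)) Φ := by
  obtain ⟨g, hg, hb⟩ := exists_bound_test_mul_Tfun (2 / |β * √(ε * μ)|) (2 / |β|) hΦ
  have hint : ∀ m, Integrable (fun q : ℝ × Spacetime => Φ q.2 *
      coords (Tfun (circleRate (β * √(ε * μ)) q.1) (circleAlpha β q.1) q.2) m)
      (circleMeasure.prod volume) := fun m => by
    have hm := measurable_coords_Tfun (continuous_circleRate (β * √(ε * μ))).measurable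
      (continuous_circleAlpha β).measurable m
    refine (hg.comp_snd circleMeasure).mono'
      ((hΦ.continuous.measurable.comp measurable_snd).mul hm).aestronglyMeasurable
      (Eventually.of_forall fun q => ?_)
    exact hb _ _ (norm_circleRate_le _ _) (norm_circleAlpha_le _ _) q.2 m
  constructor
  · intro m
    simp only [coords_regular]
    exact (hint m).integral_prod_left
  · refine BQ.ext_coords fun m => ?_
    simp only [coords_smul, coords_bqIntegral, coords_regular]
    rw [integral_integral_swap (hint m), ← integral_const_mul]
    congr 1
    ext p
    rw [coords_green_eq_mean β ε μ hβ hεμ, integral_const_mul]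
    ring

/-- By `chiralM_regular`, M is a finite combination of pairings with derivatives of φ, multiplied by
constants, and each pairing commutes with the circle mean. -/
theorem chiralM_regular_green_eq_mean (β ε μ : ℝ) (hβ : β ≠ 0) (hεμ : 0 < ε * μ)
    {φ : Spacetime → ℂ} (hφ : IsTest φ) :
    chiralM β ε μ (regular (green β ε μ)) φ = (2 * Real.pi * ((β * √(ε * μ) : ℝ) : ℂ))⁻¹ •
      bqIntegral circleMeasure fun θ =>
        chiralM β ε μ (regular (Tfun (circleRate (β * √(ε * μ)) θ) (circleAlpha β θ))) φ := by
  have hT := hφ.fderiv_apply dirT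
  have h1 := fun k => regular_green_eq_mean β ε μ hβ hεμ (hT.fderiv_apply (dirX k))
  have h2 := regular_green_eq_mean β ε μ hβ hεμ hT
  have h3 := fun k => regular_green_eq_mean β ε μ hβ hεμ (hφ.fderiv_apply (dirX k))
  have i1 := BQIntegrable.sum_unit_mul fun k => (h1 k).1
  have i3 := BQIntegrable.sum_unit_mul fun k => (h3 k).1
  simp only [chiralM_regular]
  rw [bqIntegral_add ((i1.const_smul _).sub (h2.1.const_smul _)) (i3.const_smul _),
    bqIntegral_sub (i1.const_smul _) (h2.1.const_smul _), bqIntegral_const_smul,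
    bqIntegral_const_smul, bqIntegral_const_smul, bqIntegral_sum_unit_mul fun k => (h1 k).1,
    bqIntegral_sum_unit_mul fun k => (h3 k).1, h2.2]
  simp only [(h1 _).2, (h3 _).2]
  have hc : ∀ (c : ℂ) (p q : BQ), p * c • q = c • (p * q) := fun c p q =>
    Algebra.mul_smul_comm _ _ _
  simp only [hc, Fin.sum_univ_three]
  refine BQ.ext_coords fun m => ?_
  simp only [coords_add, coords_sub, coords_smul]
  ring

/-- For fixed x ≠ 0, K_α is a power series in 1/w, so w⁻¹K_α has no constant term and its mean is
zero. -/
theorem integral_circle_inv_mul_regular_Kfun (β : ℝ) {ψ : E3 → ℂ} (hψ : IsTest ψ) (m : Fin 4) :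
    Integrable (fun θ => (circleMap 0 1 θ)⁻¹ * coords (regular (Kfun (circleAlpha β θ)) ψ) m)
      circleMeasure ∧
    ∫ θ, (circleMap 0 1 θ)⁻¹ * coords (regular (Kfun (circleAlpha β θ)) ψ) m ∂circleMeasure
      = 0 := by
  obtain ⟨R, hR, hsupp⟩ := HasCompactSupport.exists_radius hψ.2
  obtain ⟨M, hM0, hM⟩ := HasCompactSupport.exists_norm_le hψ.2 hψ.continuous
  obtain ⟨g, hg, hg0, hb⟩ := exists_bound_Kfun (2 / |β|) R
  have hinv := continuous_circle_inv
  have hint : Integrable (fun q : ℝ × E3 => (circleMap 0 1 q.1)⁻¹ *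
      (ψ q.2 * coords (Kfun (circleAlpha β q.1) q.2) m)) (circleMeasure.prod volume) := by
    have e : Measurable fun q : ℝ × E3 => (circleAlpha β q.1, q.2) :=
      ((continuous_circleAlpha β).measurable.comp measurable_fst).prodMk measurable_snd
    have hK := (measurable_coords_Kfun m).comp e
    simp only [Function.comp_def] at hK
    refine ((hg.const_mul M).comp_snd circleMeasure).mono'
      ((hinv.measurable.comp measurable_fst).mul
        ((hψ.continuous.measurable.comp measurable_snd).mul hK)).aestronglyMeasurable
      (Eventually.of_forall fun q => ?_)
    rw [norm_mul, norm_inv, norm_circle, inv_one, one_mul, norm_mul]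
    by_cases hq : ‖q.2‖ ≤ R
    · exact mul_le_mul (hM _) (hb _ (norm_circleAlpha_le β _) _ hq m) (norm_nonneg _) hM0
    · rw [hsupp _ (not_le.1 hq), norm_zero, zero_mul]
      exact mul_nonneg hM0 (hg0 _)
  simp only [coords_regular, ← integral_const_mul]
  refine ⟨hint.integral_prod_left, ?_⟩
  rw [integral_integral_swap hint]
  refine integral_eq_zero_of_ae (Eventually.of_forall fun x => ?_)
  have hi : ∀ (c : ℂ) (k : ℕ), IntegrableOn (fun θ => c *
      (Complex.exp (Complex.I * ‖x‖ / β * (circleMap 0 1 θ)⁻¹) *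
        (Complex.exp (0 * circleMap 0 1 θ) * (circleMap 0 1 θ)⁻¹ ^ k)))
      (Set.Ioc 0 (2 * Real.pi)) := fun c k => integrableOn_circle (by
        have := continuous_circleMap 0 1
        fun_prop)
  -- The trivial factor exp(0·w) brings the integrand to the form of `integral_circle_cexp_cexp`
  -- with B = 0, whose value contains Bᵏ = 0 for k = 1, 2.
  have h2 : ∀ θ, (circleMap 0 1 θ)⁻¹ * (ψ x * coords (Kfun (circleAlpha β θ) x) m) =
      ψ x * coords (Kfun ((1 / β : ℝ) : ℂ) x) m *
          (Complex.exp (Complex.I * ‖x‖ / β * (circleMap 0 1 θ)⁻¹) *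
            (Complex.exp (0 * circleMap 0 1 θ) * (circleMap 0 1 θ)⁻¹ ^ 1))
        + ψ x * (1 / β) * coords (Vfun ((1 / β : ℝ) : ℂ) x) m *
          (Complex.exp (Complex.I * ‖x‖ / β * (circleMap 0 1 θ)⁻¹) *
            (Complex.exp (0 * circleMap 0 1 θ) * (circleMap 0 1 θ)⁻¹ ^ 2)) := by
    intro θ
    have h3 : Complex.I * (1 / β * (circleMap 0 1 θ)⁻¹) * ‖x‖ =
      Complex.I * ‖x‖ / β * (circleMap 0 1 θ)⁻¹ := by ring
    rw [circleAlpha, coords_Kfun_add, h3, zero_mul, Complex.exp_zero]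
    ring
  simp only [h2]
  rw [circleMeasure, integral_add (hi _ 1) (hi _ 2), integral_const_mul, integral_const_mul,
    integral_circle_cexp_cexp, integral_circle_cexp_cexp]
  simp

/-- For fixed t the integrand is a multiple of w e^{Bw}, an entire function vanishing at 0; Cauchy's
theorem makes its mean zero. -/
theorem integral_circle_mul_timePairing (b : ℝ) {φ : Spacetime → ℂ} (hφ : IsTest φ) :
    Integrable (fun θ => circleMap 0 1 θ * timePairing (circleRate b θ) φ) circleMeasure ∧
    ∫ θ, circleMap 0 1 θ * timePairing (circleRate b θ) φ ∂circleMeasure = 0 := by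
  have hcs := hφ.hasCompactSupport_time 0
  have hcont : Continuous fun t : ℝ => φ (t, 0) := hφ.continuous.comp (by fun_prop)
  obtain ⟨R, hR, hsupp⟩ := HasCompactSupport.exists_radius hcs
  have hc := continuous_circleMap 0 1
  have hint : Integrable (fun q : ℝ × ℝ => circleMap 0 1 q.1 *
      (φ (q.2, 0) * causalExp (circleRate b q.1) q.2)) (circleMeasure.prod volume) := by
    have e : Measurable fun q : ℝ × ℝ => (circleRate b q.1, q.2) :=
      ((continuous_circleRate b).measurable.comp measurable_fst).prodMk measurable_snd
    have hK := measurable_causalExp.comp e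
    simp only [Function.comp_def] at hK
    have hi : Integrable fun t : ℝ => φ (t, 0) := hcont.integrable_of_hasCompactSupport hcs
    refine ((hi.norm.mul_const (Real.exp (2 / |b| * R))).comp_snd circleMeasure).mono'
      ((hc.measurable.comp measurable_fst).mul
        ((hcont.measurable.comp measurable_snd).mul hK)).aestronglyMeasurable
      (Eventually.of_forall fun q => ?_)
    rw [norm_mul, norm_circle, one_mul, norm_mul]
    by_cases hq : ‖q.2‖ ≤ R
    · gcongr
      exact norm_causalExp_le (norm_circleRate_le b _) hq
    · rw [hsupp _ (not_le.1 hq)]; simp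
  simp only [timePairing, ← integral_const_mul]
  refine ⟨hint.integral_prod_left, ?_⟩
  rw [integral_integral_swap hint]
  refine integral_eq_zero_of_ae (Eventually.of_forall fun t => ?_)
  have h2 : ∀ θ, circleMap 0 1 θ * (φ (t, 0) * causalExp (circleRate b θ) t) =
      φ (t, 0) * heaviside t * Complex.exp (Complex.I / b * t) *
        (circleMap 0 1 θ * Complex.exp (Complex.I / b * t * circleMap 0 1 θ)) := by
    intro θ
    have h3 : Complex.exp (circleRate b θ * t) = Complex.exp (Complex.I / b * t) *
        Complex.exp (Complex.I / b * t * circleMap 0 1 θ) := by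
      rw [← Complex.exp_add, circleRate]
      congr 1
      ring
    rw [causalExp, h3]
    ring
  simp only [h2]
  rw [circleMeasure, integral_const_mul, integral_circle_mul_cexp, mul_zero]
  rfl

theorem isFundamentalSolution_green (β ε μ : ℝ) (hβ : β ≠ 0) (hεμ : 0 < ε * μ) :
    IsFundamentalSolution (chiralM β ε μ) (green β ε μ) := by
  refine ⟨locallyIntegrable_green β ε μ hβ hεμ, fun φ hφ => ?_⟩
  rw [chiralM_regular_green_eq_mean β ε μ hβ hεμ hφ]
  have ha : 0 < √(ε * μ) := Real.sqrt_pos.2 hεμ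
  have hac : ((√(ε * μ) : ℝ) : ℂ) ≠ 0 := by exact_mod_cast ha.ne'
  have hβ' : (β : ℂ) ≠ 0 := by exact_mod_cast hβ
  have hbc : ((β * √(ε * μ) : ℝ) : ℂ) = β * ((√(ε * μ) : ℝ) : ℂ) := by push_cast; ring
  -- The circle parametrizes the dispersion relation: bl − i = iw, and both sides equal i(w + 1)/β.
  have hcirc : ∀ θ, circleAlpha β θ *
      (((β * √(ε * μ) : ℝ) : ℂ) * circleRate (β * √(ε * μ)) θ - Complex.I) =
      ((√(ε * μ) : ℝ) : ℂ) * circleRate (β * √(ε * μ)) θ := fun θ => by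
    have h0 := circle_ne_zero θ
    rw [circleAlpha, circleRate, hbc]
    push_cast
    field_simp
    ring
  simp only [fun θ => chiralM_Tfun β ε μ (hcirc θ) hφ]
  have e1 : ∀ θ, ((√(ε * μ) : ℝ) : ℂ) - ((β * √(ε * μ) : ℝ) : ℂ) * circleAlpha β θ =
      -((√(ε * μ) : ℝ) : ℂ) * (circleMap 0 1 θ)⁻¹ := fun θ => by
    have h0 := circle_ne_zero θ
    rw [circleAlpha, hbc]
    push_cast
    field_simp
    ring
  have e2 : ∀ θ, ((β * √(ε * μ) : ℝ) : ℂ) * circleRate (β * √(ε * μ)) θ - Complex.I =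
      Complex.I * circleMap 0 1 θ := fun θ => by
    rw [circleRate, hbc]
    field_simp
    ring
  simp only [e1, e2]
  refine BQ.ext_coords fun m => ?_
  obtain ⟨i1, z1⟩ := integral_circle_inv_mul_regular_Kfun β (hφ.slice 0) m
  obtain ⟨i2, z2⟩ := integral_circle_mul_timePairing (β * √(ε * μ)) hφ
  simp only [coords_smul, coords_bqIntegral, coords_add]
  have hfun : ∀ θ, ((β * √(ε * μ) : ℝ) : ℂ) * φ 0 * coords (1 : BQ) m +
      -((√(ε * μ) : ℝ) : ℂ) * (circleMap 0 1 θ)⁻¹ *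
        coords (regular (Kfun (circleAlpha β θ)) fun x => φ (0, x)) m +
      Complex.I * circleMap 0 1 θ * timePairing (circleRate (β * √(ε * μ)) θ) φ *
        coords (1 : BQ) m =
      (((β * √(ε * μ) : ℝ) : ℂ) * φ 0 * coords (1 : BQ) m +
      -((√(ε * μ) : ℝ) : ℂ) * ((circleMap 0 1 θ)⁻¹ *
        coords (regular (Kfun (circleAlpha β θ)) fun x => φ (0, x)) m)) +
      Complex.I * coords (1 : BQ) m *
        (circleMap 0 1 θ * timePairing (circleRate (β * √(ε * μ)) θ) φ) := fun θ => by ring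
  simp only [hfun]
  have h12 : Integrable (fun θ => ((β * √(ε * μ) : ℝ) : ℂ) * φ 0 * coords (1 : BQ) m +
      -((√(ε * μ) : ℝ) : ℂ) * ((circleMap 0 1 θ)⁻¹ *
        coords (regular (Kfun (circleAlpha β θ)) fun x => φ (0, x)) m)) circleMeasure :=
    (integrable_const _).add (i1.const_mul _)
  rw [integral_add h12 (i2.const_mul _),
    integral_add (integrable_const _) (i1.const_mul _), integral_const, integral_const_mul,
    integral_const_mul, z1, z2]
  -- Only the constant term bφ(0) is left; its integral 2πbφ(0) is cancelled by the normalization.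
  have hvol : circleMeasure.real Set.univ = 2 * Real.pi := by
    simp [circleMeasure, Real.pi_pos.le]
  have hπ : (Real.pi : ℂ) ≠ 0 := by exact_mod_cast Real.pi_ne_zero
  rw [hvol, Complex.real_smul, hbc]
  push_cast
  field_simp
  ring

end ChiralMaxwell

end

theorem mainTheorem2 (β ε μ : ℝ) (hβ : β ≠ 0) (hεμ : 0 < ε * μ) :
    -- `f` is a fundamental solution of `M`
    ChiralMaxwell.IsFundamentalSolution (ChiralMaxwell.chiralM β ε μ)
      (ChiralMaxwell.green β ε μ) ∧
    -- causality
    (∀ (t : ℝ) (x : ChiralMaxwell.E3), t < 0 → ChiralMaxwell.green β ε μ (t, x) = 0) ∧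
    -- `F(z, ·)` is a fundamental solution of the Fourier transformed operator
    (∀ z : ℂ, z.im ≤ 0 → z ≠ ((1 / (β * √(ε * μ)) : ℝ) : ℂ) →
      ChiralMaxwell.IsFundamentalSolution (ChiralMaxwell.chiralMHat β ε μ z)
        (ChiralMaxwell.FourierGreen β ε μ z)) ∧
    -- `f` is the regularized inverse Fourier transform of `F`
    (∀ (t : ℝ) (x : ChiralMaxwell.E3), t ≠ 0 → x ≠ 0 →
      ∃ fy : ℝ → ChiralMaxwell.BQ,
        (∀ y : ℝ, 0 < y → ChiralMaxwell.HasInverseFourier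
          (fun w : ℝ => ChiralMaxwell.FourierGreen β ε μ ((w : ℂ) - Complex.I * (y : ℂ)) x)
          t (fy y)) ∧
        ChiralMaxwell.BQTendsto fy (𝓝[>] (0 : ℝ)) (ChiralMaxwell.green β ε μ (t, x))) :=
  ⟨ChiralMaxwell.isFundamentalSolution_green β ε μ hβ hεμ,
    fun _ x ht => ChiralMaxwell.green_of_neg β ε μ ht x,
    fun _ _ hz => ChiralMaxwell.isFundamentalSolution_FourierGreen β ε μ hβ hεμ hz,
    fun t x ht _ => ChiralMaxwell.regularized_inverse_Fourier β ε μ hβ hεμ t x ht⟩
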